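/- Let $n$ and $k$ be integers with $1\le k\le n-1$, and let $\mathcal N$ be the real vector space (hence smooth manifold) of real symmetric $n\times n$ matrices $A=(a_{ij})$ of bandwidth at most $k$, that is, with $a_{ij}=0$ whenever $|i-j|>k$. Let $\mathcal D\subset\mathcal N$ be the set of derogatory matrices in $\mathcal N$, i.e., those having an eigenvalue of geometric multiplicity greater than $1$. Then $\mathcal D$ has codimension $2$ in $\mathcal N$, in the following sense: there is a nonempty relatively open subset $\mathcal M$ of $\mathcal D$ that is a smooth embedded submanifold of $\mathcal N$ with $$\dim\mathcal N-\dim\mathcal M=2,$$ and the exceptional set $\mathcal D\setminus\mathcal M$ is either empty or of Hausdorff dimension strictly less than $\dim\mathcal M=\dim\mathcal N-2$. If moreover $n\ge 3$, then the same is true of the derogatory matrices whose bandwidth $\max\{|i-j| : a_{ij}\neq 0\}$ is exactly $k$ (these lie in the open subset of $\mathcal N$ of matrices of bandwidth exactly $k$): they have codimension $2$ in the same sense. -/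

import Mathlib

open scoped ContDiff ENNReal

/- Matrices carry the entrywise sup norm.  All norms on a finite-dimensional real vector space are
equivalent, so smoothness and Hausdorff dimension do not depend on this choice. -/
attribute [local instance] Matrix.normedAddCommGroup Matrix.normedSpace

/-- A square matrix is derogatory if one of its eigenvalues has geometric multiplicity greater
than one.  (All complex eigenvalues of a real symmetric matrix are real, so for those matrices it
is enough to look at real eigenvalues.) -/
def IsDerogatory {K : Type*} [Field K] {n : ℕ} (A : Matrix (Fin n) (Fin n) K) : Prop :=
  ∃ μ : K, 1 < Module.finrank K (Module.End.eigenspace (Matrix.toLin' A) μ)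

open Classical in
/-- The bandwidth `max {|j - i| : A i j ≠ 0}` (and `0` for the zero matrix). -/
noncomputable def bandwidth {K : Type*} [Zero K] {n : ℕ} (A : Matrix (Fin n) (Fin n) K) : ℕ :=
  (Finset.univ.filter fun p : Fin n × Fin n => A p.1 p.2 ≠ 0).sup
    fun p => ((p.2 : ℤ) - (p.1 : ℤ)).natAbs

theorem bandwidth_le_iff {K : Type*} [Zero K] {n : ℕ} (A : Matrix (Fin n) (Fin n) K) (k : ℕ) :
    bandwidth A ≤ k ↔ ∀ i j : Fin n, k < ((j : ℤ) - (i : ℤ)).natAbs → A i j = 0 := by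
  classical
  simp only [bandwidth, Finset.sup_le_iff, Finset.mem_filter, Finset.mem_univ, true_and,
    Prod.forall]
  refine forall_congr' fun i => forall_congr' fun j => ?_
  rw [← not_lt, not_imp_not]

/-- The manifold of real symmetric `n × n` matrices of bandwidth (at most) `k`: a linear subspace
of the space of all matrices. -/
def bandedSymm (n k : ℕ) : Submodule ℝ (Matrix (Fin n) (Fin n) ℝ) where
  carrier := {A | A.IsSymm ∧ bandwidth A ≤ k}
  zero_mem' := ⟨Matrix.isSymm_zero, (bandwidth_le_iff _ _).2 fun _ _ _ => rfl⟩
  add_mem' := by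
    rintro A B ⟨hA, hA'⟩ ⟨hB, hB'⟩
    rw [bandwidth_le_iff] at hA' hB'
    refine ⟨hA.add hB, (bandwidth_le_iff _ _).2 fun i j h => ?_⟩
    rw [Matrix.add_apply, hA' i j h, hB' i j h, add_zero]
  smul_mem' := by
    rintro c A ⟨hA, hA'⟩
    rw [bandwidth_le_iff] at hA'
    refine ⟨hA.smul c, (bandwidth_le_iff _ _).2 fun i j h => ?_⟩
    rw [Matrix.smul_apply, hA' i j h, smul_zero]

/-- `M` is a smooth embedded submanifold of dimension `d` of the vector space `E`: around each of
its points there is a smooth chart of `E` that straightens `M` to a linear subspace of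
dimension `d`. -/
def IsEmbeddedSubmanifold {E : Type*} [NormedAddCommGroup E] [NormedSpace ℝ E]
    (d : ℕ) (M : Set E) : Prop :=
  ∀ x ∈ M, ∃ (φ : OpenPartialHomeomorph E E) (L : Submodule ℝ E),
    x ∈ φ.source ∧ ContDiffOn ℝ ∞ φ φ.source ∧ ContDiffOn ℝ ∞ φ.symm φ.target ∧
      Module.finrank ℝ L = d ∧ φ '' (φ.source ∩ M) = φ.target ∩ (L : Set E)

/-- `D` has codimension `c` in the finite-dimensional space `E`: apart from a relatively closed
exceptional subset of smaller dimension, `D` is a nonempty smooth embedded submanifold `M` of `E`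
with `dim E - dim M = c`. The exceptional subset is empty if `D` itself is a submanifold. -/
def HasCodimension {E : Type*} [NormedAddCommGroup E] [NormedSpace ℝ E]
    (D : Set E) (c : ℕ) : Prop :=
  ∃ (d : ℕ) (V : Set E), IsOpen V ∧ (D ∩ V).Nonempty ∧ IsEmbeddedSubmanifold d (D ∩ V) ∧
    Module.finrank ℝ E = d + c ∧ ((D \ V).Nonempty → dimH (D \ V) < (d : ℝ≥0∞))

open Topology Set Module

set_option linter.unusedSectionVars false

/-! ### Hausdorff dimension of zero sets, and submanifolds cut out by submersions -/

section Dimension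

variable {X Y Z N : Type*} [NormedAddCommGroup X] [NormedSpace ℝ X] [FiniteDimensional ℝ X]
  [NormedAddCommGroup Y] [NormedSpace ℝ Y] [FiniteDimensional ℝ Y]
  [AddCommGroup Z] [Module ℝ Z] [NormedAddCommGroup N] [NormedSpace ℝ N]

/-! Write `N` for the dimension of the space of banded symmetric matrices. A double eigenvalue costs
three equations, the vanishing of the compression of `A - μ` to a plane, against one free parameter
`μ`; hence codimension 2. The count is correct near `A` if, for a basis `x`, `y` of the eigenspace,
`H ↦ (xᵀHx, yᵀHx, yᵀHy)` maps the banded matrices onto `ℝ³`. For a basis reduced at two pivots,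
diagonal matrices take care of the outer entries. The mixed entry needs indices `p`, `q` within the
band with `x p * y q + x q * y p ≠ 0`; this can fail only for a far pair (`exists_band_ne_zero`). So
if `A` has just one multiple eigenvalue, which is exactly double and without far pair, the implicit
function theorem makes the derogatory set a submanifold near `A` (`exists_submanifold_nhds`).

The other derogatory matrices have a far pair, an eigenvalue of multiplicity at least 3, or two
distinct multiple eigenvalues, and form a set of dimension at most `N - 3` (`dimH_exceptional_le`).
Each bound adjoins eigenvalues and vectors as unknowns, exhibits a space of directions on which the
linearised equations are injective, and projects back to the matrices
(`dimH_le_of_eigenvector_incidence`).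

- Far pairs: the disjoint supports let the diagonal entries be varied independently for the two
vectors (`dimH_farPair_le`). - Triple eigenvalues: the eigenspace contains a plane vanishing at the
first coordinate. Such planes are handled by descent through trailing principal submatrices
(`dimH_doubleTail_le`), whose kernels are `tailKer a a`. - Two double eigenvalues `μ ≠ ν`: if fewer
than three of the four first-order conditions were independent, eigenvectors normalised at the first
coordinate would agree on all indices met by the first row of `A`, and that row would give `μ = ν`
(`exists_three_independent_of_orthogonal`).

An explicit matrix with a nondegenerate double eigenvalue shows that the smooth part is nonempty. -/

theorem dimH_submodule (K : Submodule ℝ X) : dimH (K : Set X) = finrank ℝ K := by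
  have h := (isometry_subtype_coe (s := (K : Set X))).dimH_image univ
  rw [image_univ, Subtype.range_coe] at h
  rw [h]
  exact Real.dimH_univ_eq_finrank K

theorem finrank_ker_add_le_of_injective_comp (L : X →ₗ[ℝ] Y) (ι : Z →ₗ[ℝ] X)
    (h : Function.Injective (L ∘ₗ ι)) : finrank ℝ (LinearMap.ker L) + finrank ℝ Z ≤ finrank ℝ X := by
  have h1 := L.finrank_range_add_finrank_ker
  have h2 := LinearMap.finrank_range_of_inj h
  have h3 : finrank ℝ (LinearMap.range (L ∘ₗ ι)) ≤ finrank ℝ (LinearMap.range L) :=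
    Submodule.finrank_mono (LinearMap.range_comp_le_range ι L)
  omega

/-- Near a point, the zero set of a `C¹` map has at most the dimension of the kernel of its
derivative. -/
theorem exists_mem_nhds_dimH_image_zeroSet_le {F : X → Y} {p : X} (hF : ContDiffAt ℝ 1 F p)
    (f : X →L[ℝ] N) : ∃ W ∈ 𝓝 p, dimH (f '' (W ∩ {z | F z = 0})) ≤
      finrank ℝ (LinearMap.ker (fderiv ℝ F p : X →ₗ[ℝ] Y)) := by
  set L : X →ₗ[ℝ] Y := (fderiv ℝ F p : X →ₗ[ℝ] Y) with hL
  set K := LinearMap.ker L with hK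
  obtain ⟨P, hP⟩ := (LinearMap.range L).subtype.exists_leftInverse_of_injective
    (LinearMap.range L).ker_subtype
  obtain ⟨s, hs⟩ := L.rangeRestrict.exists_rightInverse_of_surjective L.range_rangeRestrict
  let σ' : Y →L[ℝ] X := (s ∘ₗ P).toContinuousLinearMap
  have hσ : ∀ z, L (σ' (L z)) = L z := by
    intro z
    have h1 : P (L z) = ⟨L z, L.mem_range_self z⟩ :=
      congrArg (fun g => g ⟨L z, L.mem_range_self z⟩) hP
    have h2 := congrArg Subtype.val (congrArg (fun g => g ⟨L z, L.mem_range_self z⟩) hs)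
    change L (s (P (L z))) = L z
    rw [h1]
    exact h2
  -- Because `L σ' L = L`, the map `Θ` sends zeros of `F` into `ker L`, whatever the rank of `L`.
  -- Its derivative at `p` is the identity, so it has a locally Lipschitz inverse.
  let Θ : X → X := fun z => z + σ' (F z - fderiv ℝ F p z)
  have hΘ : ContDiffAt ℝ 1 Θ p := contDiffAt_id.add
    (σ'.contDiff.contDiffAt.comp p (hF.sub (fderiv ℝ F p).contDiff.contDiffAt))
  have hΘ' : HasFDerivAt Θ ((ContinuousLinearEquiv.refl ℝ X : X ≃L[ℝ] X) : X →L[ℝ] X) p := by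
    have h1 := (hasFDerivAt_id (𝕜 := ℝ) p).add ((σ'.hasFDerivAt (x := F p - fderiv ℝ F p p)).comp p
      ((hF.differentiableAt one_ne_zero).hasFDerivAt.sub (fderiv ℝ F p).hasFDerivAt))
    convert! h1 using 1
    ext z
    simp
  let φ := hΘ.toOpenPartialHomeomorph Θ hΘ' one_ne_zero
  have hinv : ContDiffAt ℝ 1 φ.symm (Θ p) := hΘ.to_localInverse hΘ' one_ne_zero
  obtain ⟨C, t, ht, hlip⟩ := hinv.exists_lipschitzOnWith
  have hps : p ∈ φ.source := hΘ.mem_toOpenPartialHomeomorph_source hΘ' one_ne_zero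
  refine ⟨φ.source ∩ Θ ⁻¹' t, Filter.inter_mem (φ.open_source.mem_nhds hps)
    (hΘ.continuousAt.preimage_mem_nhds ht), ?_⟩
  have hsub : (φ.source ∩ Θ ⁻¹' t) ∩ {z | F z = 0} ⊆ φ.symm '' (t ∩ (K : Set X)) := by
    rintro z ⟨⟨hz, hzt⟩, hz0⟩
    refine ⟨Θ z, ⟨hzt, ?_⟩, φ.left_inv hz⟩
    have : L (Θ z) = 0 := by
      change L (z + σ' (F z - L z)) = 0
      rw [hz0, zero_sub, map_neg, map_add, map_neg, hσ, add_neg_cancel]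
    exact this
  calc dimH (f '' _) ≤ dimH ((φ.source ∩ Θ ⁻¹' t) ∩ {z | F z = 0}) := f.lipschitz.dimH_image_le _
    _ ≤ dimH (φ.symm '' (t ∩ (K : Set X))) := dimH_mono hsub
    _ ≤ dimH (t ∩ (K : Set X)) := (hlip.mono inter_subset_left).dimH_image_le
    _ ≤ dimH (K : Set X) := dimH_mono inter_subset_right
    _ = _ := dimH_submodule K

/-- A countable subcover suffices, and the Hausdorff dimension of a countable union is the supremum.
-/
theorem dimH_image_le_of_locally {T : Set X} {f : X → N} {m : ℝ≥0∞}
    (h : ∀ p ∈ T, ∃ W ∈ 𝓝 p, dimH (f '' (W ∩ T)) ≤ m) : dimH (f '' T) ≤ m := by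
  choose! W hW hd using h
  obtain ⟨t, htT, htc, ht⟩ := TopologicalSpace.countable_cover_nhdsWithin
    (fun p hp => mem_nhdsWithin_of_mem_nhds (hW p hp) : ∀ p ∈ T, W p ∈ 𝓝[T] p)
  have : f '' T ⊆ ⋃ p ∈ t, f '' (W p ∩ T) := by
    rintro _ ⟨z, hz, rfl⟩
    obtain ⟨p, hp, hzp⟩ := mem_iUnion₂.1 (ht hz)
    exact mem_iUnion₂.2 ⟨p, hp, z, ⟨hzp, hz⟩, rfl⟩
  refine (dimH_mono this).trans ?_
  rw [dimH_bUnion htc]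
  exact iSup₂_le fun p hp => hd p (htT hp)

/-- Dimension bound for the projection of an incidence set cut out by `C¹` equations whose
derivatives are injective on a subspace of the size of `Z`. -/
theorem dimH_image_le_of_fderiv_injective {F : X → Y} (hF : ContDiff ℝ 1 F) {T : Set X}
    (hT : ∀ p ∈ T, F p = 0) (f : X →L[ℝ] N) {m : ℕ} (hm : finrank ℝ X ≤ m + finrank ℝ Z)
    (h : ∀ p ∈ T, ∃ ι : Z →ₗ[ℝ] X, ∀ z, fderiv ℝ F p (ι z) = 0 → z = 0) :
    dimH (f '' T) ≤ m := by
  refine dimH_image_le_of_locally fun p hp => ?_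
  obtain ⟨W, hW, hd⟩ := exists_mem_nhds_dimH_image_zeroSet_le (hF.contDiffAt (x := p)) f
  obtain ⟨ι, hι⟩ := h p hp
  refine ⟨W, hW, (dimH_mono (image_mono (inter_subset_inter_right _ hT))).trans (hd.trans ?_)⟩
  have := finrank_ker_add_le_of_injective_comp (fderiv ℝ F p : X →ₗ[ℝ] Y) ι
    ((injective_iff_map_eq_zero _).2 hι)
  exact_mod_cast (by omega)

/-- A set locally cut out by an analytic submersion is a submanifold. -/
theorem exists_isEmbeddedSubmanifold_of_submersion {D : Set X} {x : X} {h : X → Y} {d : ℕ}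
    (hh : ContDiffAt ℝ ω h x) (hsurj : Function.Surjective (fderiv ℝ h x))
    (hD : ∀ᶠ z in 𝓝 x, z ∈ D ↔ h z = 0) (hd : finrank ℝ X = d + finrank ℝ Y) :
    ∃ U, IsOpen U ∧ x ∈ U ∧ IsEmbeddedSubmanifold d (D ∩ U) := by
  set h' := fderiv ℝ h x with hh'
  obtain ⟨σ, hσ⟩ := (h' : X →ₗ[ℝ] Y).exists_rightInverse_of_surjective
    (LinearMap.range_eq_top.2 hsurj)
  let σ' : Y →L[ℝ] X := σ.toContinuousLinearMap
  have hσ' : ∀ y, h' (σ' y) = y := fun y => congrArg (fun g => g y) hσ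
  -- Now `σ'` is a right inverse of `h'`, so `h' ∘ Θ = h` and `Θ` carries the zeros of `h` exactly
  -- to `ker h'`.
  let Θ : X → X := fun z => z + σ' (h z - h' z)
  have hΘ : ContDiffAt ℝ ω Θ x :=
    contDiffAt_id.add (σ'.contDiff.contDiffAt.comp x (hh.sub h'.contDiff.contDiffAt))
  have hΘ' : HasFDerivAt Θ ((ContinuousLinearEquiv.refl ℝ X : X ≃L[ℝ] X) : X →L[ℝ] X) x := by
    have h1 := (hasFDerivAt_id (𝕜 := ℝ) x).add ((σ'.hasFDerivAt (x := h x - h' x)).comp x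
      ((hh.differentiableAt (by simp)).hasFDerivAt.sub h'.hasFDerivAt))
    convert! h1 using 1
    ext z
    simp [← hh']
  have hω : (ω : WithTop ℕ∞) ≠ 0 := by simp
  let φ := hΘ.toOpenPartialHomeomorph Θ hΘ' hω
  have hxs : x ∈ φ.source := hΘ.mem_toOpenPartialHomeomorph_source hΘ' hω
  obtain ⟨U, hU, hUo, hxU⟩ := mem_nhds_iff.1 hD
  -- The chart is cut down to where it and its inverse are analytic and where `D` is described by
  -- `h`.
  let ψ := (φ.restrContDiff ℝ ω (by simp)).restrOpen U hUo
  have hψ : ∀ z, ψ z = Θ z := fun z => rfl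
  have hψs : ψ.source ⊆ U := by
    intro z hz
    have : z ∈ (φ.restrContDiff ℝ ω (by simp)).source ∩ U := by
      simpa [ψ, OpenPartialHomeomorph.restrOpen_source] using hz
    exact this.2
  have hsmooth : ContDiffOn ℝ ∞ ψ ψ.source := by
    refine ((φ.contDiffOn_restrContDiff_source ℝ (n := ω) (by simp)).mono ?_).of_le (by simp)
    intro z hz
    have : z ∈ (φ.restrContDiff ℝ ω (by simp)).source ∩ U := by
      simpa [ψ, OpenPartialHomeomorph.restrOpen_source] using hz
    exact this.1
  have hsmooth' : ContDiffOn ℝ ∞ ψ.symm ψ.target := by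
    refine ((φ.contDiffOn_restrContDiff_target ℝ (n := ω) (by simp)).mono ?_).of_le (by simp)
    intro z hz
    have h1 : ψ.symm z ∈ (φ.restrContDiff ℝ ω (by simp)).source ∩ U := by
      simpa [ψ, OpenPartialHomeomorph.restrOpen_source] using ψ.map_target hz
    have h2 := (φ.restrContDiff ℝ ω (by simp)).map_source h1.1
    rwa [show (φ.restrContDiff ℝ ω (by simp)) (ψ.symm z) = z from ψ.right_inv hz] at h2
  have hxψ : x ∈ ψ.source := by
    have : x ∈ (φ.restrContDiff ℝ ω (by simp)).source ∩ U :=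
      ⟨⟨hxs, hΘ, hΘ.to_localInverse hΘ' hω⟩, hxU⟩
    simpa [ψ, OpenPartialHomeomorph.restrOpen_source] using this
  refine ⟨ψ.source, ψ.open_source, hxψ, fun y hy => ⟨ψ, LinearMap.ker (h' : X →ₗ[ℝ] Y), hy.2,
    hsmooth, hsmooth', ?_, ?_⟩⟩
  · have h1 := (h' : X →ₗ[ℝ] Y).finrank_range_add_finrank_ker
    rw [LinearMap.range_eq_top.2 hsurj, finrank_top] at h1
    omega
  · have key : ∀ z, Θ z ∈ LinearMap.ker (h' : X →ₗ[ℝ] Y) ↔ h z = 0 := by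
      intro z
      have : h' (Θ z) = h z := by
        change h' (z + σ' (h z - h' z)) = _
        rw [map_add, hσ']; abel
      rw [LinearMap.mem_ker]
      change h' (Θ z) = 0 ↔ _
      rw [this]
    ext w
    constructor
    · rintro ⟨z, ⟨hz, hzD, -⟩, rfl⟩
      exact ⟨ψ.map_source hz, (key z).2 ((hU (hψs hz)).1 hzD)⟩
    · rintro ⟨hw, hwL⟩
      have hz := ψ.map_target hw
      refine ⟨ψ.symm w, ⟨hz, ?_, hz⟩, ψ.right_inv hw⟩
      refine (hU (hψs hz)).2 ((key _).1 ?_)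
      rw [← hψ, ψ.right_inv hw]
      exact hwL

end Dimension

/-! ### The incidence method for matrices with prescribed eigenvectors -/

/-- Multiplication of a vector by a banded symmetric matrix. -/
noncomputable def bandedMulVec (n k : ℕ) :
    bandedSymm n k →L[ℝ] (Fin n → ℝ) →L[ℝ] (Fin n → ℝ) :=
  LinearMap.toContinuousLinearMap
    ((LinearMap.toContinuousLinearMap (𝕜 := ℝ) (E := Fin n → ℝ) (F' := Fin n → ℝ)).toLinearMap ∘ₗ
      (Matrix.toLin' (R := ℝ) (m := Fin n) (n := Fin n)).toLinearMap ∘ₗ (bandedSymm n k).subtype)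

@[simp] theorem bandedMulVec_apply {n k : ℕ} (A : bandedSymm n k) (x : Fin n → ℝ) :
    bandedMulVec n k A x = (A : Matrix (Fin n) (Fin n) ℝ).mulVec x := rfl

/-- Dimension bound for a set of banded symmetric matrices that carry approximate eigenvectors:
`C i` is the set of coordinates at which the `i`-th vector is normalised. -/
theorem dimH_le_of_eigenvector_incidence {n k : ℕ} (a : ℕ) {E ι : Type} [Fintype E] [Fintype ι]
    (π : ι → E) (C : ι → Set (Fin n)) (c : ι → Fin n → ℝ) (S : Set (bandedSymm n k))
    {Z : Type*} [AddCommGroup Z] [Module ℝ Z] {m : ℕ}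
    (hm : finrank ℝ (bandedSymm n k) + (Fintype.card E + Fintype.card ι * n) ≤ m + finrank ℝ Z)
    (h : ∀ A ∈ S, ∃ (μ : E → ℝ) (v : ι → Fin n → ℝ),
      (∀ i l, a ≤ l.val → (A.1.mulVec (v i)) l = μ (π i) * v i l) ∧
      (∀ i, ∀ l ∈ C i, v i l = c i l) ∧
      ∃ j : Z →ₗ[ℝ] bandedSymm n k × (E → ℝ) × (ι → Fin n → ℝ), ∀ z,
        (∀ i l, a ≤ l.val → (A.1.mulVec ((j z).2.2 i)) l + ((j z).1.1.mulVec (v i)) l =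
          μ (π i) * (j z).2.2 i l + (j z).2.1 (π i) * v i l) →
        (∀ i, ∀ l ∈ C i, (j z).2.2 i l = 0) → z = 0) :
    dimH S ≤ m := by
  classical
  let X := bandedSymm n k × (E → ℝ) × (ι → Fin n → ℝ)
  let p1 : X →L[ℝ] bandedSymm n k := ContinuousLinearMap.fst ℝ _ _
  let p2 : E → X →L[ℝ] ℝ := fun e =>
    (ContinuousLinearMap.proj e).comp
      ((ContinuousLinearMap.fst ℝ _ _).comp (ContinuousLinearMap.snd ℝ _ _))
  let p3 : ι → X →L[ℝ] (Fin n → ℝ) := fun i =>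
    (ContinuousLinearMap.proj (φ := fun _ : ι => Fin n → ℝ) i).comp
      ((ContinuousLinearMap.snd ℝ _ _).comp (ContinuousLinearMap.snd ℝ _ _))
  -- Rows below `a`, and in `Q` the coordinates outside `C i`, receive the trivial equation `0 = 0`,
  -- so the target space does not depend on the pattern.
  let P : (Fin n → ℝ) →L[ℝ] (Fin n → ℝ) := ContinuousLinearMap.pi fun l =>
    if a ≤ l.val then ContinuousLinearMap.proj l else 0
  let Q : X →L[ℝ] (ι → Fin n → ℝ) := ContinuousLinearMap.pi fun i => ContinuousLinearMap.pi fun l =>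
    if l ∈ C i then (ContinuousLinearMap.proj l).comp (p3 i) else 0
  have hP : ∀ w, P w = 0 ↔ ∀ l : Fin n, a ≤ l.val → w l = 0 := by
    intro w
    constructor
    · intro hw l hl
      have := congrFun hw l
      simpa [P, hl] using this
    · intro hw
      ext l
      by_cases hl : a ≤ l.val <;> simp [P, hl, hw]
  have hQ : ∀ z i l, Q z i l = if l ∈ C i then z.2.2 i l else 0 := by
    intro z i l
    by_cases hl : l ∈ C i
    · simp only [Q, ContinuousLinearMap.coe_pi', if_pos hl]; rfl
    · simp only [Q, ContinuousLinearMap.coe_pi', if_neg hl]; rfl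
  let c' : ι → Fin n → ℝ := fun i l => if l ∈ C i then c i l else 0
  let r : ι → X → (Fin n → ℝ) := fun i z =>
    bandedMulVec n k (p1 z) (p3 i z) - p2 (π i) z • p3 i z
  let F : X → (ι → Fin n → ℝ) × (ι → Fin n → ℝ) := fun z => (fun i => P (r i z), Q z - c')
  have hr : ∀ i, ContDiff ℝ 1 (r i) := fun i =>
    ((((bandedMulVec n k).contDiff.comp p1.contDiff).clm_apply (p3 i).contDiff)).sub
      ((p2 (π i)).contDiff.smul (p3 i).contDiff)
  have hr' : ∀ i z w, fderiv ℝ (r i) z w = bandedMulVec n k (p1 z) (p3 i w) +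
      bandedMulVec n k (p1 w) (p3 i z) - (p2 (π i) z • p3 i w + p2 (π i) w • p3 i z) := by
    intro i z w
    have h1 : HasFDerivAt (fun z => bandedMulVec n k (p1 z)) ((bandedMulVec n k).comp p1) z :=
      ((bandedMulVec n k).comp p1).hasFDerivAt
    have h2 := (h1.clm_apply (p3 i).hasFDerivAt).sub
      ((p2 (π i)).hasFDerivAt.smul (p3 i).hasFDerivAt (x := z))
    have h3 : fderiv ℝ (r i) z = _ := h2.fderiv
    rw [h3]
    rfl
  have hF : ContDiff ℝ 1 F :=
    (contDiff_pi.2 fun i => P.contDiff.comp (hr i)).prodMk (Q.contDiff.sub contDiff_const)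
  have hF' : ∀ z w, fderiv ℝ F z w = (fun i => P (fderiv ℝ (r i) z w), Q w) := by
    intro z w
    have h1 : ∀ i, HasFDerivAt (fun z => P (r i z)) (P.comp (fderiv ℝ (r i) z)) z := fun i =>
      P.hasFDerivAt.comp z (((hr i).differentiable one_ne_zero) z).hasFDerivAt
    have h2 := (hasFDerivAt_pi.2 h1).prodMk (Q.hasFDerivAt.sub_const c' (x := z))
    have h3 : fderiv ℝ F z = _ := h2.fderiv
    rw [h3]
    rfl
  let T : Set X := {z | F z = 0 ∧ ∃ j : Z →ₗ[ℝ] X, ∀ w, fderiv ℝ F z (j w) = 0 → w = 0}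
  have hST : S ⊆ p1 '' T := by
    intro A hA
    obtain ⟨μ, v, h1, h2, j, hj⟩ := h A hA
    refine ⟨(A, μ, v), ⟨?_, j, fun w hw => ?_⟩, rfl⟩
    · refine Prod.ext (funext fun i => (hP _).2 fun l hl => ?_) ?_
      · change (A.1.mulVec (v i)) l - μ (π i) * v i l = 0
        rw [h1 i l hl, sub_self]
      · ext i l
        change Q (A, μ, v) i l - c' i l = 0
        rw [hQ]
        by_cases hl : l ∈ C i
        · simp [c', hl, h2 i l hl]
        · simp [c', hl]
    · rw [hF'] at hw
      obtain ⟨hw1, hw2⟩ := Prod.ext_iff.1 hw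
      refine hj w (fun i l hl => ?_) fun i l hl => ?_
      · have := (hP _).1 (congrFun hw1 i) l hl
        rw [hr'] at this
        change (A.1.mulVec ((j w).2.2 i)) l + ((j w).1.1.mulVec (v i)) l -
          (μ (π i) * (j w).2.2 i l + (j w).2.1 (π i) * v i l) = 0 at this
        exact sub_eq_zero.1 this
      · have := congrFun (congrFun hw2 i) l
        simp only [hQ, if_pos hl] at this
        exact this
  refine (dimH_mono hST).trans (dimH_image_le_of_fderiv_injective hF (T := T) (fun p hp => hp.1) p1
    (m := m) ?_ fun p hp => hp.2)
  simpa [X, Module.finrank_pi_fintype] using hm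

/-! ### Reduced pairs of vectors in a subspace -/

section Pivot

variable {m : Type*} [Fintype m] {K : Submodule ℝ (m → ℝ)}

theorem exists_ne_zero_apply_eq_zero (hK : 2 ≤ finrank ℝ K) (i : m) :
    ∃ u ∈ K, u ≠ 0 ∧ u i = 0 := by
  by_contra! h
  have hinj : Function.Injective ((LinearMap.proj i : (m → ℝ) →ₗ[ℝ] ℝ) ∘ₗ K.subtype) := by
    refine (injective_iff_map_eq_zero _).2 fun u hu => ?_
    by_contra h0
    exact h u u.2 (fun h1 => h0 (Subtype.ext h1)) hu
  have := LinearMap.finrank_le_finrank_of_injective hinj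
  rw [finrank_self] at this
  omega

/-- A subspace of dimension at least two has a pair of vectors in reduced form at two pivots,
the first of which can be any coordinate that does not vanish on the subspace. -/
theorem exists_pivots_of_apply_ne_zero (hK : 2 ≤ finrank ℝ K) {i : m} {v : m → ℝ} (hv : v ∈ K)
    (hvi : v i ≠ 0) :
    ∃ j, ∃ x ∈ K, ∃ y ∈ K, x i = 1 ∧ x j = 0 ∧ y i = 0 ∧ y j = 1 := by
  obtain ⟨u, hu, hu0, hui⟩ := exists_ne_zero_apply_eq_zero hK i
  obtain ⟨j, hj⟩ := Function.ne_iff.1 hu0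
  rw [Pi.zero_apply] at hj
  refine ⟨j, (v i)⁻¹ • (v - (v j / u j) • u), K.smul_mem _ (K.sub_mem hv (K.smul_mem _ hu)),
    (u j)⁻¹ • u, K.smul_mem _ hu, ?_, ?_, ?_, ?_⟩
  · simp [hui, hvi]
  · simp [hj]
  · simp [hui]
  · simp [hj]

theorem exists_pivots (hK : 2 ≤ finrank ℝ K) :
    ∃ i j, ∃ x ∈ K, ∃ y ∈ K, x i = 1 ∧ x j = 0 ∧ y i = 0 ∧ y j = 1 := by
  have : K ≠ ⊥ := by
    rintro rfl
    simp at hK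
  obtain ⟨v, hv, hv0⟩ := K.exists_mem_ne_zero_of_ne_bot this
  obtain ⟨i, hi⟩ := Function.ne_iff.1 hv0
  exact ⟨i, exists_pivots_of_apply_ne_zero hK hv hi⟩

variable {i j : m} {x y : m → ℝ}

theorem linearIndependent_of_pivots (hxi : x i = 1) (hxj : x j = 0) (hyi : y i = 0)
    (hyj : y j = 1) : LinearIndependent ℝ ![x, y] := by
  refine LinearIndependent.pair_iff.2 fun s t h => ⟨?_, ?_⟩
  · simpa [hxi, hyi] using congrFun h i
  · simpa [hxj, hyj] using congrFun h j

theorem two_le_finrank_of_pivots (hx : x ∈ K) (hy : y ∈ K) (hxi : x i = 1) (hxj : x j = 0)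
    (hyi : y i = 0) (hyj : y j = 1) : 2 ≤ finrank ℝ K := by
  have h : LinearIndependent ℝ ![(⟨x, hx⟩ : K), ⟨y, hy⟩] := by
    refine LinearIndependent.pair_iff.2 fun s t h => ?_
    exact LinearIndependent.pair_iff.1 (linearIndependent_of_pivots hxi hxj hyi hyj) s t
      (congrArg Subtype.val h)
  simpa using h.fintype_card_le_finrank

/-- The pivots make the dimension exactly two, and then the coordinates `i`, `j` identify `K` with
`ℝ × ℝ`. -/
theorem eq_zero_of_pivots (hK : finrank ℝ K ≤ 2) (hx : x ∈ K) (hy : y ∈ K) (hxi : x i = 1)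
    (hxj : x j = 0) (hyi : y i = 0) (hyj : y j = 1) {w : m → ℝ} (hw : w ∈ K) (hwi : w i = 0)
    (hwj : w j = 0) : w = 0 := by
  let f : K →ₗ[ℝ] ℝ × ℝ := ((LinearMap.proj i).prod (LinearMap.proj j)) ∘ₗ K.subtype
  have hf : Function.Surjective f := by
    rintro ⟨s, t⟩
    refine ⟨s • ⟨x, hx⟩ + t • ⟨y, hy⟩, ?_⟩
    simp [f, hxi, hxj, hyi, hyj]
  have hfr : finrank ℝ K = finrank ℝ (ℝ × ℝ) := by
    have h1 := two_le_finrank_of_pivots hx hy hxi hxj hyi hyj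
    rw [finrank_prod, finrank_self]
    omega
  have hinj := (LinearMap.injective_iff_surjective_of_finrank_eq_finrank hfr).2 hf
  have : (⟨w, hw⟩ : K) = 0 := hinj (by simp [f, hwi, hwj])
  exact congrArg Subtype.val this

theorem eq_smul_add_smul_of_pivots (h0 : ∀ w ∈ K, w i = 0 → w j = 0 → w = 0) (hx : x ∈ K)
    (hy : y ∈ K) (hxi : x i = 1) (hxj : x j = 0) (hyi : y i = 0) (hyj : y j = 1) {w : m → ℝ}
    (hw : w ∈ K) : w = w i • x + w j • y :=
  sub_eq_zero.1 <| h0 _ (K.sub_mem hw (K.add_mem (K.smul_mem _ hx) (K.smul_mem _ hy)))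
    (by simp [hxi, hyi]) (by simp [hxj, hyj])

end Pivot

/-! ### Kernels of trailing submatrices and elementary banded matrices -/

section Band

variable {n : ℕ}

/-- The vectors that vanish in the coordinates below `b` and whose product with `B` vanishes in
the coordinates from `a` on. -/
def tailKer (a b : ℕ) (B : Matrix (Fin n) (Fin n) ℝ) : Submodule ℝ (Fin n → ℝ) where
  carrier := {w | (∀ l, l.val < b → w l = 0) ∧ ∀ l, a ≤ l.val → B.mulVec w l = 0}
  zero_mem' := ⟨fun _ _ => rfl, fun l _ => by simp⟩
  add_mem' := by
    rintro u v ⟨hu, hu'⟩ ⟨hv, hv'⟩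
    refine ⟨fun l hl => ?_, fun l hl => ?_⟩
    · simp [hu l hl, hv l hl]
    · simp [Matrix.mulVec_add, hu' l hl, hv' l hl]
  smul_mem' := by
    rintro c u ⟨hu, hu'⟩
    refine ⟨fun l hl => ?_, fun l hl => ?_⟩
    · simp [hu l hl]
    · simp [Matrix.mulVec_smul, hu' l hl]

theorem mem_tailKer {a b : ℕ} {B : Matrix (Fin n) (Fin n) ℝ} {w : Fin n → ℝ} :
    w ∈ tailKer a b B ↔ (∀ l, l.val < b → w l = 0) ∧ ∀ l, a ≤ l.val → B.mulVec w l = 0 := Iff.rfl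

theorem sub_smul_one_mulVec (A : Matrix (Fin n) (Fin n) ℝ) (μ : ℝ) (w : Fin n → ℝ) :
    (A - μ • 1).mulVec w = A.mulVec w - μ • w := by
  rw [Matrix.sub_mulVec, Matrix.smul_mulVec, Matrix.one_mulVec]

theorem mem_tailKer_sub_smul {a b : ℕ} {A : Matrix (Fin n) (Fin n) ℝ} {μ : ℝ} {w : Fin n → ℝ} :
    w ∈ tailKer a b (A - μ • 1) ↔
      (∀ l, l.val < b → w l = 0) ∧ ∀ l, a ≤ l.val → A.mulVec w l = μ * w l := by
  simp only [mem_tailKer, sub_smul_one_mulVec, Pi.sub_apply, Pi.smul_apply, smul_eq_mul,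
    sub_eq_zero]

theorem mem_tailKer_zero_zero {A : Matrix (Fin n) (Fin n) ℝ} {μ : ℝ} {w : Fin n → ℝ} :
    w ∈ tailKer 0 0 (A - μ • 1) ↔ A.mulVec w = μ • w := by
  simp [mem_tailKer_sub_smul, funext_iff]

theorem isDerogatory_iff {A : Matrix (Fin n) (Fin n) ℝ} :
    IsDerogatory A ↔ ∃ μ : ℝ, 2 ≤ finrank ℝ (tailKer 0 0 (A - μ • 1)) := by
  have : ∀ μ : ℝ, Module.End.eigenspace (Matrix.toLin' A) μ = tailKer 0 0 (A - μ • 1) := by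
    intro μ
    ext w
    rw [mem_tailKer_zero_zero, Module.End.mem_eigenspace_iff, Matrix.toLin'_apply]
  exact exists_congr fun μ => by rw [this μ]; exact Iff.rfl

theorem IsSymm.dotProduct_mulVec_comm {B : Matrix (Fin n) (Fin n) ℝ} (hB : B.IsSymm)
    (x y : Fin n → ℝ) : x ⬝ᵥ B.mulVec y = y ⬝ᵥ B.mulVec x := by
  rw [Matrix.dotProduct_mulVec, ← Matrix.mulVec_transpose, hB.eq, dotProduct_comm]

theorem dotProduct_eq_zero_of_forall {x y : Fin n → ℝ} (h : ∀ l, x l = 0 ∨ y l = 0) :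
    x ⬝ᵥ y = 0 :=
  Finset.sum_eq_zero fun l _ => mul_eq_zero.2 (h l)

/-- Elements of the tail kernel are orthogonal to the image of the vectors supported in the
tail. -/
theorem dotProduct_mulVec_eq_zero_of_mem_tailKer {a : ℕ} {B : Matrix (Fin n) (Fin n) ℝ}
    (hB : B.IsSymm) {x w : Fin n → ℝ} (hx : x ∈ tailKer a a B) (hw : ∀ l, l.val < a → w l = 0) :
    x ⬝ᵥ B.mulVec w = 0 := by
  rw [IsSymm.dotProduct_mulVec_comm hB]
  refine dotProduct_eq_zero_of_forall fun l => ?_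
  rcases lt_or_ge l.val a with hl | hl
  · exact Or.inl (hw l hl)
  · exact Or.inr (hx.2 l hl)

/-- The symmetric matrix with entries at `(l, m)` and `(m, l)`. -/
def symUnit (l m : Fin n) : Matrix (Fin n) (Fin n) ℝ := Matrix.single l m 1 + Matrix.single m l 1

theorem symUnit_mulVec (l m : Fin n) (x : Fin n → ℝ) :
    (symUnit l m).mulVec x = Pi.single l (x m) + Pi.single m (x l) := by
  rw [symUnit, Matrix.add_mulVec, Matrix.single_mulVec, Matrix.single_mulVec, one_mul, one_mul]
  rfl

theorem dotProduct_symUnit_mulVec (l m : Fin n) (x y : Fin n → ℝ) :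
    x ⬝ᵥ (symUnit l m).mulVec y = x l * y m + x m * y l := by
  rw [symUnit_mulVec, dotProduct_add, dotProduct_single, dotProduct_single]

theorem symUnit_mem {k : ℕ} {l m : Fin n} (h : ((m : ℤ) - (l : ℤ)).natAbs ≤ k) :
    symUnit l m ∈ bandedSymm n k := by
  refine ⟨?_, (bandwidth_le_iff _ _).2 fun i j hij => ?_⟩
  · simp [symUnit, Matrix.IsSymm, Matrix.transpose_add, Matrix.transpose_single, add_comm]
  · have h1 : ¬(l = i ∧ m = j) := by rintro ⟨rfl, rfl⟩; omega
    have h2 : ¬(m = i ∧ l = j) := by rintro ⟨rfl, rfl⟩; omega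
    simp [symUnit, h1, h2]

/-- `symUnit` as an element of the space of banded matrices. -/
def bandUnit {k : ℕ} (l m : Fin n) (h : ((m : ℤ) - (l : ℤ)).natAbs ≤ k) : bandedSymm n k :=
  ⟨symUnit l m, symUnit_mem h⟩


theorem apply_eq_zero_of_mem {k : ℕ} {A : Matrix (Fin n) (Fin n) ℝ} (hA : A ∈ bandedSymm n k)
    {i j : Fin n} (h : k < ((j : ℤ) - (i : ℤ)).natAbs) : A i j = 0 :=
  (bandwidth_le_iff _ _).1 hA.2 i j h

theorem sub_smul_one_isSymm {k : ℕ} (A : bandedSymm n k) (μ : ℝ) :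
    (A.1 - μ • (1 : Matrix (Fin n) (Fin n) ℝ)).IsSymm :=
  A.2.1.sub (Matrix.isSymm_one.smul μ)

end Band

/-! ### Eigenvectors with supports far apart -/

section FarPair

variable {n k : ℕ}

/-- Two nonzero vectors of the tail kernel whose supports are more than `k` apart. -/
def HasFarPair (k a : ℕ) (B : Matrix (Fin n) (Fin n) ℝ) : Prop :=
  ∃ x ∈ tailKer a a B, ∃ y ∈ tailKer a a B, x ≠ 0 ∧ y ≠ 0 ∧
    ∀ l m : Fin n, ((m : ℤ) - (l : ℤ)).natAbs ≤ k → x l * y m = 0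

/-- A proper nonempty subset of a tail of `Fin n` has a neighbour in the tail. -/
theorem exists_neighbour (hk : 0 < k) {a : ℕ} {X : Set (Fin n)} {i j : Fin n} (hi : i ∈ X)
    (hj : j ∉ X) (hai : a ≤ i.val) (haj : a ≤ j.val) :
    ∃ l m : Fin n, a ≤ l.val ∧ l ∉ X ∧ m ∈ X ∧ ((m : ℤ) - (l : ℤ)).natAbs ≤ k := by
  by_contra! h
  have up : ∀ t (ht : t < n), i.val ≤ t → (⟨t, ht⟩ : Fin n) ∈ X := by
    intro t ht hit
    induction t, hit using Nat.le_induction with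
    | base => exact hi
    | succ t hit ih =>
      by_contra hX
      have := h ⟨t + 1, ht⟩ ⟨t, by omega⟩ (by simp only; omega) hX (ih (by omega))
      simp only at this
      omega
  have down : ∀ s t, (ht : t < n) → a ≤ t → i.val = t + s → (⟨t, ht⟩ : Fin n) ∈ X := by
    intro s
    induction s with
    | zero =>
      intro t ht _ hs
      have : i = ⟨t, ht⟩ := Fin.ext (by simpa using hs)
      exact this ▸ hi
    | succ s ih =>
      intro t ht hat hs
      by_contra hX
      have := h ⟨t, ht⟩ ⟨t + 1, by omega⟩ hat hX (ih (t + 1) (by omega) (by omega) (by omega))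
      simp only at this
      omega
  rcases le_total i.val j.val with hij | hij
  · exact hj (up j j.2 hij)
  · exact hj (down (i.val - j.val) j j.2 haj (by omega))

/-- A diagonal matrix as an element of the space of banded matrices. -/
def bandDiagonal (n k : ℕ) : (Fin n → ℝ) →ₗ[ℝ] bandedSymm n k :=
  (Matrix.diagonalLinearMap (Fin n) ℝ ℝ).codRestrict (bandedSymm n k) fun d =>
    ⟨Matrix.isSymm_diagonal d, (bandwidth_le_iff _ _).2 fun i j hij =>
      Matrix.diagonal_apply_ne _ (by rintro rfl; simp at hij)⟩

theorem bandDiagonal_mulVec (d x : Fin n → ℝ) (l : Fin n) :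
    (bandDiagonal n k d).1.mulVec x l = d l * x l :=
  Matrix.mulVec_diagonal d x l

/-- On the support of a vector its row equations are moved by diagonal entries, independently for
the two disjoint supports; off the support the coordinate itself is normalised to `0`. This gives
`2n` directions. Two band entries leading out of the supports and the two scalings raise the number
to `2n + 4`, against `N + 1 + 2n` unknowns. -/
theorem dimH_farPair_pattern_le (hk : 0 < k) (a : ℕ) (X Y : Set (Fin n)) (i₀ j₀ : Fin n) :
    dimH {A : bandedSymm n k | ∃ (μ : ℝ) (x y : Fin n → ℝ), x ∈ tailKer a a (A.1 - μ • 1) ∧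
      y ∈ tailKer a a (A.1 - μ • 1) ∧ (∀ l, x l ≠ 0 ↔ l ∈ X) ∧ (∀ l, y l ≠ 0 ↔ l ∈ Y) ∧
      x i₀ = 1 ∧ y j₀ = 1 ∧ ∀ l m : Fin n, ((m : ℤ) - (l : ℤ)).natAbs ≤ k → x l * y m = 0} ≤
      ((finrank ℝ (bandedSymm n k) - 3 : ℕ) : ℝ≥0∞) := by
  classical
  refine dimH_le_of_eigenvector_incidence (Z := (Fin n → ℝ) × (Fin n → ℝ) × ℝ × ℝ × ℝ × ℝ) a
    (E := Unit) (ι := Fin 2) (fun _ => ()) ![{l | l ∉ X ∨ l = i₀}, {l | l ∉ Y ∨ l = j₀}]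
    ![Pi.single i₀ 1, Pi.single j₀ 1] _ ?_ ?_
  · simp only [Fintype.card_unit, Fintype.card_fin, finrank_prod, finrank_self, finrank_fin_fun]
    omega
  rintro A ⟨μ, x, y, hx, hy, hX, hY, hxi, hyj, hfar⟩
  have hX0 : ∀ l, l ∉ X → x l = 0 := fun l hl => not_not.1 fun h => hl ((hX l).1 h)
  have hY0 : ∀ l, l ∉ Y → y l = 0 := fun l hl => not_not.1 fun h => hl ((hY l).1 h)
  have hiX : i₀ ∈ X := (hX _).1 (by rw [hxi]; exact one_ne_zero)
  have hjY : j₀ ∈ Y := (hY _).1 (by rw [hyj]; exact one_ne_zero)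
  have hfarX : ∀ l m : Fin n, ((m : ℤ) - (l : ℤ)).natAbs ≤ k → m ∈ X → l ∉ Y := by
    intro l m hlm hm hl
    exact mul_ne_zero ((hX m).2 hm) ((hY l).2 hl) (hfar m l (by omega))
  have hdisj : ∀ l, l ∈ X → l ∉ Y := fun l => hfarX l l (by simp)
  have hai : a ≤ i₀.val := by
    by_contra! h
    exact (hX _).2 hiX (hx.1 _ h)
  have haj : a ≤ j₀.val := by
    by_contra! h
    exact (hY _).2 hjY (hy.1 _ h)
  -- Row `l₁` of the equation for `x` lies outside the support, where no diagonal entry acts; the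
  -- entry at `(l₁, m₁)` moves it because `x m₁ ≠ 0`. Likewise `(l₂, m₂)` for `y`.
  obtain ⟨l₁, m₁, hl₁, hl₁X, hm₁X, hlm₁⟩ :=
    exists_neighbour hk hiX (fun h => hdisj _ h hjY) hai haj
  obtain ⟨l₂, m₂, hl₂, hl₂Y, hm₂Y, hlm₂⟩ :=
    exists_neighbour hk hjY (fun h => hdisj _ hiX h) haj hai
  have hl₁Y : l₁ ∉ Y := hfarX _ _ hlm₁ hm₁X
  have hm₁Y : m₁ ∉ Y := hdisj _ hm₁X
  have hm₂X : m₂ ∉ X := fun h => hdisj _ h hm₂Y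
  have hl₂X : l₂ ∉ X := fun h => hfarX m₂ l₂ (by omega) h hm₂Y
  rw [mem_tailKer_sub_smul] at hx hy
  let j : ((Fin n → ℝ) × (Fin n → ℝ) × ℝ × ℝ × ℝ × ℝ) →ₗ[ℝ]
      bandedSymm n k × (Unit → ℝ) × (Fin 2 → Fin n → ℝ) :=
    { toFun := fun z =>
        (bandDiagonal n k (fun l => if l ∈ X then z.1 l else if l ∈ Y then z.2.1 l else 0) +
          z.2.2.1 • bandUnit l₁ m₁ hlm₁ + z.2.2.2.1 • bandUnit l₂ m₂ hlm₂, 0,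
          ![fun l => (if l ∈ X then 0 else z.1 l) + if l = i₀ then z.2.2.2.2.1 else 0,
            fun l => (if l ∈ Y then 0 else z.2.1 l) + if l = j₀ then z.2.2.2.2.2 else 0])
      map_add' := by
        intro z w
        refine Prod.ext ?_ (Prod.ext (by simp) ?_)
        · have : (fun l => if l ∈ X then (z + w).1 l else if l ∈ Y then (z + w).2.1 l else 0) =
              (fun l => if l ∈ X then z.1 l else if l ∈ Y then z.2.1 l else 0) +
              (fun l => if l ∈ X then w.1 l else if l ∈ Y then w.2.1 l else 0) := by
            ext l
            simp only [Pi.add_apply]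
            split_ifs <;> simp
          dsimp only
          rw [this, map_add]
          simp only [Prod.fst_add, Prod.snd_add, add_smul]
          abel
        · ext i l
          fin_cases i <;> simp <;> split_ifs <;> ring
      map_smul' := by
        intro r z
        refine Prod.ext ?_ (Prod.ext (by simp) ?_)
        · have : (fun l => if l ∈ X then (r • z).1 l else if l ∈ Y then (r • z).2.1 l else 0) =
              r • (fun l => if l ∈ X then z.1 l else if l ∈ Y then z.2.1 l else 0) := by
            ext l
            simp only [Pi.smul_apply]
            split_ifs <;> simp
          dsimp only
          rw [this, map_smul]
          simp only [Prod.smul_fst, Prod.smul_snd, smul_add, smul_assoc, RingHom.id_apply]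
        · ext i l
          fin_cases i <;> simp <;> split_ifs <;> ring }
  refine ⟨fun _ => μ, ![x, y], ?_, ?_, j, ?_⟩
  · intro i l hl
    fin_cases i
    · exact hx.2 l hl
    · exact hy.2 l hl
  · intro i l hl
    fin_cases i
    · change x l = (Pi.single i₀ 1 : Fin n → ℝ) l
      by_cases h : l = i₀
      · subst h; simp [hxi]
      · rw [Pi.single_eq_of_ne h, hX0 l (hl.resolve_right h)]
    · change y l = (Pi.single j₀ 1 : Fin n → ℝ) l
      by_cases h : l = j₀
      · subst h; simp [hyj]
      · rw [Pi.single_eq_of_ne h, hY0 l (hl.resolve_right h)]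
  rintro ⟨c, d, α, β, γ, δ⟩ h1 h2
  have hc : ∀ l, l ∉ X → c l = 0 := by
    intro l hl
    have hli : l ≠ i₀ := fun h => hl (h ▸ hiX)
    simpa [j, hl, hli] using h2 0 l (Or.inl hl)
  have hd : ∀ l, l ∉ Y → d l = 0 := by
    intro l hl
    have hli : l ≠ j₀ := fun h => hl (h ▸ hjY)
    simpa [j, hl, hli] using h2 1 l (Or.inl hl)
  have hγ : γ = 0 := by simpa [j, hiX] using h2 0 i₀ (Or.inr rfl)
  have hδ : δ = 0 := by simpa [j, hjY] using h2 1 j₀ (Or.inr rfl)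
  have hdv : (j (c, d, α, β, γ, δ)).2.2 = 0 := by
    ext i l
    fin_cases i
    · simp only [j, LinearMap.coe_mk, AddHom.coe_mk, hγ]
      by_cases hl : l ∈ X <;> simp [hl, hc]
    · simp only [j, LinearMap.coe_mk, AddHom.coe_mk, hδ]
      by_cases hl : l ∈ Y <;> simp [hl, hd]
  have hH : ∀ w l, (j (c, d, α, β, γ, δ)).1.1.mulVec w l =
      (if l ∈ X then c l else if l ∈ Y then d l else 0) * w l +
      α * ((Pi.single l₁ (w m₁) : Fin n → ℝ) l + (Pi.single m₁ (w l₁) : Fin n → ℝ) l) +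
      β * ((Pi.single l₂ (w m₂) : Fin n → ℝ) l + (Pi.single m₂ (w l₂) : Fin n → ℝ) l) := by
    intro w l
    change ((bandDiagonal n k _).1 + α • symUnit l₁ m₁ + β • symUnit l₂ m₂).mulVec w l = _
    rw [Matrix.add_mulVec, Matrix.add_mulVec, Matrix.smul_mulVec, Matrix.smul_mulVec,
      symUnit_mulVec, symUnit_mulVec, Pi.add_apply, Pi.add_apply, bandDiagonal_mulVec]
    rfl
  have h3 : ∀ i l, a ≤ l.val →
      (j (c, d, α, β, γ, δ)).1.1.mulVec ((![x, y] : Fin 2 → Fin n → ℝ) i) l = 0 := by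
    intro i l hl
    have := h1 i l hl
    rw [hdv] at this
    simpa [j] using this
  have hxa : ∀ l, l ∈ X → a ≤ l.val := fun l hl => by
    by_contra! h
    exact (hX _).2 hl (hx.1 _ h)
  have hya : ∀ l, l ∈ Y → a ≤ l.val := fun l hl => by
    by_contra! h
    exact (hY _).2 hl (hy.1 _ h)
  have hα : α = 0 := by
    have := h3 0 l₁ hl₁
    rw [hH] at this
    simpa [hX0 _ hl₁X, hX0 _ hm₂X, hX0 _ hl₂X, (hX m₁).2 hm₁X] using this
  have hβ : β = 0 := by
    have := h3 1 l₂ hl₂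
    rw [hH] at this
    simpa [hY0 _ hl₂Y, hY0 _ hm₁Y, hY0 _ hl₁Y, (hY m₂).2 hm₂Y] using this
  have hc' : c = 0 := by
    ext l
    by_cases hl : l ∈ X
    · have := h3 0 l (hxa l hl)
      rw [hH, hα, hβ] at this
      simpa [hl, (hX l).2 hl] using this
    · exact hc l hl
  have hd' : d = 0 := by
    ext l
    by_cases hl : l ∈ Y
    · have := h3 1 l (hya l hl)
      rw [hH, hα, hβ] at this
      have hlX : l ∉ X := fun h => hdisj l h hl
      simpa [hl, hlX, (hY l).2 hl] using this
    · exact hd l hl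
  simp [hα, hβ, hγ, hδ, hc', hd']

/-- After scaling, only finitely many choices of supports and normalised coordinates occur. -/
theorem dimH_farPair_le (hk : 0 < k) (a : ℕ) :
    dimH {A : bandedSymm n k | ∃ μ : ℝ, HasFarPair k a (A.1 - μ • 1)} ≤
      ((finrank ℝ (bandedSymm n k) - 3 : ℕ) : ℝ≥0∞) := by
  let I := Set (Fin n) × Set (Fin n) × Fin n × Fin n
  let S : I → Set (bandedSymm n k) := fun p => {A : bandedSymm n k | ∃ (μ : ℝ) (x y : Fin n → ℝ),
      x ∈ tailKer a a (A.1 - μ • 1) ∧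
      y ∈ tailKer a a (A.1 - μ • 1) ∧ (∀ l, x l ≠ 0 ↔ l ∈ p.1) ∧ (∀ l, y l ≠ 0 ↔ l ∈ p.2.1) ∧
      x p.2.2.1 = 1 ∧ y p.2.2.2 = 1 ∧
      ∀ l m : Fin n, ((m : ℤ) - (l : ℤ)).natAbs ≤ k → x l * y m = 0}
  have hsub : {A : bandedSymm n k | ∃ μ : ℝ, HasFarPair k a (A.1 - μ • 1)} ⊆ ⋃ p, S p := by
    rintro A ⟨μ, x, hx, y, hy, hx0, hy0, hfar⟩
    obtain ⟨i, hi⟩ := Function.ne_iff.1 hx0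
    obtain ⟨j, hj⟩ := Function.ne_iff.1 hy0
    rw [Pi.zero_apply] at hi hj
    refine mem_iUnion.2 ⟨({l | x l ≠ 0}, {l | y l ≠ 0}, i, j), μ, (x i)⁻¹ • x, (y j)⁻¹ • y,
      Submodule.smul_mem _ _ hx, Submodule.smul_mem _ _ hy, ?_, ?_, ?_, ?_, ?_⟩
    · simp [hi]
    · simp [hj]
    · simp [hi]
    · simp [hj]
    · intro l m hlm
      have := hfar l m hlm
      simp only [Pi.smul_apply, smul_eq_mul]
      linear_combination (x i)⁻¹ * (y j)⁻¹ * this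
  have : Countable I := Finite.to_countable
  refine (dimH_mono hsub).trans ?_
  rw [dimH_iUnion]
  exact iSup_le fun p => dimH_farPair_pattern_le hk a p.1 p.2.1 p.2.2.1 p.2.2.2

end FarPair

/-! ### Planes of eigenvectors of a trailing submatrix that vanish at its first coordinate -/

section TailKernel

variable {n k : ℕ}

theorem tailKer_mono_left {a b c : ℕ} (h : a ≤ c) (B : Matrix (Fin n) (Fin n) ℝ) :
    tailKer a b B ≤ tailKer c b B := fun _ hw => ⟨hw.1, fun l hl => hw.2 l (by omega)⟩

theorem finrank_tailKer_le_succ (a : ℕ) (B : Matrix (Fin n) (Fin n) ℝ) :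
    finrank ℝ (tailKer a a B) ≤ finrank ℝ (tailKer a (a + 1) B) + 1 := by
  rcases lt_or_ge a n with ha | ha
  · let f : tailKer a a B →ₗ[ℝ] ℝ := (LinearMap.proj ⟨a, ha⟩) ∘ₗ (tailKer a a B).subtype
    have h1 := f.finrank_range_add_finrank_ker
    have h2 : finrank ℝ (LinearMap.range f) ≤ 1 := by
      simpa using Submodule.finrank_le (LinearMap.range f)
    let g : LinearMap.ker f →ₗ[ℝ] tailKer a (a + 1) B :=
      ((tailKer a a B).subtype ∘ₗ (LinearMap.ker f).subtype).codRestrict _ fun w => by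
        refine ⟨fun l hl => ?_, w.1.2.2⟩
        rcases Nat.lt_succ_iff_lt_or_eq.1 hl with hl | hl
        · exact w.1.2.1 l hl
        · have : l = ⟨a, ha⟩ := Fin.ext hl
          exact this ▸ w.2
    have hg : Function.Injective g := fun u v huv =>
      by
      have h := congrArg Subtype.val huv
      exact Subtype.ext (Subtype.ext h)
    have h3 := LinearMap.finrank_le_finrank_of_injective hg
    omega
  · have : tailKer a a B ≤ tailKer a (a + 1) B := fun w hw =>
      ⟨fun l _ => hw.1 l (by omega), hw.2⟩
    have := Submodule.finrank_mono this
    omega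

/-- The case `l = m` gives `x l * y l = 0`. If `x l = 0` the product is zero; if `y l = 0` the
second summand drops out. -/
theorem forall_mul_eq_zero_of_symm {x y : Fin n → ℝ}
    (h : ∀ l m : Fin n, ((m : ℤ) - (l : ℤ)).natAbs ≤ k → x l * y m + x m * y l = 0) (l m : Fin n)
    (hlm : ((m : ℤ) - (l : ℤ)).natAbs ≤ k) : x l * y m = 0 := by
  have h1 := h l m hlm
  have h2 : x l * y l = 0 := by linarith [h l l (by simp)]
  rcases mul_eq_zero.1 h2 with h3 | h3
  · rw [h3, zero_mul]
  · rwa [h3, mul_zero, add_zero] at h1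

/-- The sum is the value of `xᵀHy` at `H = symUnit p q`, so without far pairs this functional is
nonzero on the banded matrices. -/
theorem exists_band_ne_zero {a : ℕ} {B : Matrix (Fin n) (Fin n) ℝ} (hB : ¬HasFarPair k a B)
    {x y : Fin n → ℝ} (hx : x ∈ tailKer a a B) (hy : y ∈ tailKer a a B) (hx0 : x ≠ 0)
    (hy0 : y ≠ 0) : ∃ p q : Fin n, ((q : ℤ) - (p : ℤ)).natAbs ≤ k ∧
      x p * y q + x q * y p ≠ 0 := by
  by_contra! h
  exact hB ⟨x, hx, y, hy, hx0, hy0, forall_mul_eq_zero_of_symm h⟩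

/-- The first-order condition on a perturbation `H` of `B` under which the perturbation `w` of a
kernel vector `v` remains in the kernel. -/
theorem dotProduct_mulVec_eq_zero_of_linearized {a : ℕ} {B H : Matrix (Fin n) (Fin n) ℝ}
    (hB : B.IsSymm) {x v w : Fin n → ℝ} (hx : x ∈ tailKer a a B)
    (hw : ∀ l, l.val < a → w l = 0)
    (h : ∀ l, a ≤ l.val → B.mulVec w l + H.mulVec v l = 0) : x ⬝ᵥ H.mulVec v = 0 := by
  have h1 : x ⬝ᵥ (B.mulVec w + H.mulVec v) = 0 := by
    refine dotProduct_eq_zero_of_forall fun l => ?_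
    rcases lt_or_ge l.val a with hl | hl
    · exact Or.inl (hx.1 l hl)
    · exact Or.inr (h l hl)
  rwa [dotProduct_add, dotProduct_mulVec_eq_zero_of_mem_tailKer hB hx hw, zero_add] at h1

theorem ne_zero_of_apply_eq_one {x : Fin n → ℝ} {i : Fin n} (h : x i = 1) : x ≠ 0 := by
  rintro rfl
  simp at h

/-- The double eigenvalue of the submatrix from `a + 1` on gives three conditions, detected by the
units at `(i, i)`, `(j, j)` and `(p, q)`. Row `a` must also annihilate `x`. The entry at `(a, a +
1)` moves that row, as `x` is nonzero at `a + 1`, and leaves the later rows alone, as `x` and `y`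
vanish at `a`. Four conditions less the unknown `μ` leave `N - 3`. -/
theorem dimH_doubleTail_pivot_le {a : ℕ} (hk : 0 < k) (ha : a + 1 < n) (i j : Fin n) :
    dimH {A : bandedSymm n k | ∃ (μ : ℝ) (x y : Fin n → ℝ),
      x ∈ tailKer a (a + 1) (A.1 - μ • 1) ∧ y ∈ tailKer a (a + 1) (A.1 - μ • 1) ∧
      x i = 1 ∧ x j = 0 ∧ y i = 0 ∧ y j = 1 ∧
      (∀ w ∈ tailKer (a + 1) (a + 1) (A.1 - μ • 1), w i = 0 → w j = 0 → w = 0) ∧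
      (∃ p q : Fin n, ((q : ℤ) - (p : ℤ)).natAbs ≤ k ∧ x p * y q + x q * y p ≠ 0) ∧
      x ⟨a + 1, ha⟩ ≠ 0} ≤
      ((finrank ℝ (bandedSymm n k) - 3 : ℕ) : ℝ≥0∞) := by
  classical
  refine dimH_le_of_eigenvector_incidence (Z := (Fin 2 → Fin n → ℝ) × ℝ × ℝ × ℝ × ℝ) a
    (E := Unit) (ι := Fin 2) (fun _ => ()) (fun _ => {l | l.val < a + 1 ∨ l = i ∨ l = j})
    ![Pi.single i 1, Pi.single j 1] _ ?_ ?_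
  · simp only [Fintype.card_unit, Fintype.card_fin, finrank_prod, finrank_self, finrank_pi_fintype,
      Finset.sum_const, Finset.card_univ, smul_eq_mul]
    omega
  rintro A ⟨μ, x, y, hx, hy, hxi, hxj, hyi, hyj, hfull, ⟨p, q, hpq, hpq0⟩, hxa⟩
  have hx' : x ∈ tailKer (a + 1) (a + 1) (A.1 - μ • 1) := tailKer_mono_left (by omega) _ hx
  have hy' : y ∈ tailKer (a + 1) (a + 1) (A.1 - μ • 1) := tailKer_mono_left (by omega) _ hy
  have hij : i ≠ j := by rintro rfl; rw [hxi] at hxj; exact one_ne_zero hxj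
  let a₀ : Fin n := ⟨a, by omega⟩
  let a₁ : Fin n := ⟨a + 1, ha⟩
  have haa : ((a₁ : ℤ) - (a₀ : ℤ)).natAbs ≤ k := by simp only [a₀, a₁]; omega
  have hx0 : x a₀ = 0 := hx.1 a₀ (by simp [a₀])
  have hy0 : y a₀ = 0 := hy.1 a₀ (by simp [a₀])
  have hii : ∀ l : Fin n, ((l : ℤ) - (l : ℤ)).natAbs ≤ k := by simp
  let J : ((Fin 2 → Fin n → ℝ) × ℝ × ℝ × ℝ × ℝ) →ₗ[ℝ]
      bandedSymm n k × (Unit → ℝ) × (Fin 2 → Fin n → ℝ) :=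
    { toFun := fun z => (z.2.1 • bandUnit i i (hii i) + z.2.2.1 • bandUnit j j (hii j) +
          z.2.2.2.1 • bandUnit p q hpq + z.2.2.2.2 • bandUnit a₀ a₁ haa, 0, z.1)
      map_add' := by
        intro z w
        refine Prod.ext ?_ (Prod.ext (by simp) rfl)
        simp only [Prod.fst_add, Prod.snd_add, add_smul]
        abel
      map_smul' := by
        intro r z
        refine Prod.ext ?_ (Prod.ext (by simp) rfl)
        simp only [Prod.smul_fst, Prod.smul_snd, smul_add, smul_assoc, RingHom.id_apply] }
  refine ⟨fun _ => μ, ![x, y], ?_, ?_, J, ?_⟩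
  · intro f l hl
    fin_cases f
    · exact (mem_tailKer_sub_smul.1 hx).2 l hl
    · exact (mem_tailKer_sub_smul.1 hy).2 l hl
  · rintro f l (hl | rfl | rfl)
    · have hli : l ≠ i := by rintro rfl; rw [hx.1 _ hl] at hxi; exact zero_ne_one hxi
      have hlj : l ≠ j := by rintro rfl; rw [hy.1 _ hl] at hyj; exact zero_ne_one hyj
      fin_cases f
      · simp [hx.1 l hl, hli]
      · simp [hy.1 l hl, hlj]
    · fin_cases f <;> simp [hxi, hyi, hij]
    · fin_cases f <;> simp [hxj, hyj, hij.symm]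
  rintro ⟨w, c₁, c₂, c₃, c₄⟩ h1 h2
  set H : Matrix (Fin n) (Fin n) ℝ :=
    c₁ • symUnit i i + c₂ • symUnit j j + c₃ • symUnit p q + c₄ • symUnit a₀ a₁ with hH
  have hH' : ∀ u v : Fin n → ℝ, u ⬝ᵥ H.mulVec v = c₁ * (u i * v i + u i * v i) +
      c₂ * (u j * v j + u j * v j) + c₃ * (u p * v q + u q * v p) +
      c₄ * (u a₀ * v a₁ + u a₁ * v a₀) := by
    intro u v
    simp only [hH, Matrix.add_mulVec, Matrix.smul_mulVec, dotProduct_add, dotProduct_smul,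
      dotProduct_symUnit_mulVec, smul_eq_mul]
  have hw : ∀ f l, l.val < a + 1 → w f l = 0 := fun f l hl => h2 f l (Or.inl hl)
  have hlin : ∀ f l, a ≤ l.val → (A.1 - μ • 1).mulVec (w f) l +
      H.mulVec ((![x, y] : Fin 2 → Fin n → ℝ) f) l = 0 := by
    intro f l hl
    have h3 : A.1.mulVec (w f) l + H.mulVec ((![x, y] : Fin 2 → Fin n → ℝ) f) l =
        μ * w f l + 0 * _ := h1 f l hl
    rw [sub_smul_one_mulVec, Pi.sub_apply, Pi.smul_apply, smul_eq_mul]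
    linarith
  have hdot : ∀ u ∈ tailKer (a + 1) (a + 1) (A.1 - μ • 1), ∀ f,
      u ⬝ᵥ H.mulVec ((![x, y] : Fin 2 → Fin n → ℝ) f) = 0 := fun u hu f =>
    dotProduct_mulVec_eq_zero_of_linearized (sub_smul_one_isSymm A μ) hu (hw f)
      fun l hl => hlin f l (by omega)
  have hc₃ : c₃ = 0 := by
    have := hdot x hx' 1
    rw [hH'] at this
    simp only [Matrix.cons_val_one, Matrix.cons_val_fin_one, hxi, hyi, hxj, hyj, hx0, hy0] at this
    have h4 : c₃ * (x p * y q + x q * y p) = 0 := by linarith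
    exact (mul_eq_zero.1 h4).resolve_right hpq0
  have hc₁ : c₁ = 0 := by
    have := hdot x hx' 0
    rw [hH', hc₃] at this
    simp only [Matrix.cons_val_zero, hxi, hxj, hx0] at this
    linarith
  have hc₂ : c₂ = 0 := by
    have := hdot y hy' 1
    rw [hH', hc₃] at this
    simp only [Matrix.cons_val_one, Matrix.cons_val_fin_one, hyi, hyj, hy0] at this
    linarith
  have hHv : ∀ v : Fin n → ℝ, v a₀ = 0 → H.mulVec v = c₄ • Pi.single a₀ (v a₁) := by
    intro v hv
    simp [hH, hc₁, hc₂, hc₃, Matrix.smul_mulVec, symUnit_mulVec, hv]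
  have hv0 : ∀ f, (![x, y] : Fin 2 → Fin n → ℝ) f a₀ = 0 := by
    intro f
    fin_cases f <;> simp [hx0, hy0]
  have hw0 : w = 0 := by
    funext f
    refine hfull _ ⟨hw f, fun l hl => ?_⟩ (h2 f i (Or.inr (Or.inl rfl)))
      (h2 f j (Or.inr (Or.inr rfl)))
    have h3 := hlin f l (by omega)
    have hla : l ≠ a₀ := by rintro rfl; simp [a₀] at hl
    rwa [hHv _ (hv0 f), Pi.smul_apply, Pi.single_eq_of_ne hla, smul_zero, add_zero] at h3
  have hc₄ : c₄ = 0 := by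
    have h3 := hlin 0 a₀ le_rfl
    rw [hHv _ (hv0 0), hw0] at h3
    simpa [a₁, hxa] using h3
  simp [hw0, hc₁, hc₂, hc₃, hc₄]

/-- Induction on the length of the tail. If the submatrix from `a + 1` on has multiplicity at least
3, or if all the vectors vanish at `a + 1`, the situation recurs one index later. Otherwise some
vector is nonzero at `a + 1`, which can serve as a pivot, unless there is a far pair. -/
theorem dimH_doubleTail_le (hk : 0 < k) (a : ℕ) :
    dimH {A : bandedSymm n k | ∃ μ : ℝ, 2 ≤ finrank ℝ (tailKer a (a + 1) (A.1 - μ • 1))} ≤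
      ((finrank ℝ (bandedSymm n k) - 3 : ℕ) : ℝ≥0∞) := by
  suffices H : ∀ s a, n ≤ a + s →
      dimH {A : bandedSymm n k | ∃ μ : ℝ, 2 ≤ finrank ℝ (tailKer a (a + 1) (A.1 - μ • 1))} ≤
        ((finrank ℝ (bandedSymm n k) - 3 : ℕ) : ℝ≥0∞) from H n a (by omega)
  have hbot : ∀ (a b : ℕ) (B : Matrix (Fin n) (Fin n) ℝ), n ≤ b → finrank ℝ (tailKer a b B) = 0 := by
    intro a b B hb
    have : tailKer a b B = ⊥ := (Submodule.eq_bot_iff _).2 fun w hw =>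
      funext fun l => hw.1 l (by omega)
    rw [this, finrank_bot]
  intro s
  induction s with
  | zero =>
    intro a ha
    have : {A : bandedSymm n k | ∃ μ : ℝ, 2 ≤ finrank ℝ (tailKer a (a + 1) (A.1 - μ • 1))} = ∅ := by
      refine eq_empty_iff_forall_notMem.2 ?_
      rintro A ⟨μ, hμ⟩
      rw [hbot _ _ _ (by omega)] at hμ
      omega
    rw [this, dimH_empty]
    exact zero_le
  | succ s ih =>
    intro a has
    rcases lt_or_ge (a + 1) n with ha | ha
    · let S : Fin n × Fin n → Set (bandedSymm n k) := fun r => {A | ∃ (μ : ℝ) (x y : Fin n → ℝ),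
        x ∈ tailKer a (a + 1) (A.1 - μ • 1) ∧ y ∈ tailKer a (a + 1) (A.1 - μ • 1) ∧
        x r.1 = 1 ∧ x r.2 = 0 ∧ y r.1 = 0 ∧ y r.2 = 1 ∧
        (∀ w ∈ tailKer (a + 1) (a + 1) (A.1 - μ • 1), w r.1 = 0 → w r.2 = 0 → w = 0) ∧
        (∃ p q : Fin n, ((q : ℤ) - (p : ℤ)).natAbs ≤ k ∧ x p * y q + x q * y p ≠ 0) ∧
        x ⟨a + 1, ha⟩ ≠ 0}
      have hsub : {A : bandedSymm n k | ∃ μ : ℝ, 2 ≤ finrank ℝ (tailKer a (a + 1) (A.1 - μ • 1))} ⊆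
          {A | ∃ μ : ℝ, 2 ≤ finrank ℝ (tailKer (a + 1) (a + 1 + 1) (A.1 - μ • 1))} ∪
          ({A | ∃ μ : ℝ, HasFarPair k (a + 1) (A.1 - μ • 1)} ∪ ⋃ r, S r) := by
        rintro A ⟨μ, hμ⟩
        set B : Matrix (Fin n) (Fin n) ℝ := A.1 - μ • 1 with hB
        by_cases h1 : 3 ≤ finrank ℝ (tailKer (a + 1) (a + 1) B)
        · refine Or.inl ⟨μ, ?_⟩
          have := finrank_tailKer_le_succ (a + 1) B
          change 2 ≤ finrank ℝ (tailKer (a + 1) (a + 1 + 1) B)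
          omega
        by_cases h2 : ∃ v ∈ tailKer a (a + 1) B, v ⟨a + 1, ha⟩ ≠ 0
        · obtain ⟨v, hv, hv0⟩ := h2
          obtain ⟨j, x, hx, y, hy, hxi, hxj, hyi, hyj⟩ :=
            exists_pivots_of_apply_ne_zero hμ hv hv0
          by_cases h3 : HasFarPair k (a + 1) B
          · exact Or.inr (Or.inl ⟨μ, h3⟩)
          have hx' : x ∈ tailKer (a + 1) (a + 1) B := tailKer_mono_left (by omega) _ hx
          have hy' : y ∈ tailKer (a + 1) (a + 1) B := tailKer_mono_left (by omega) _ hy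
          refine Or.inr (Or.inr (mem_iUnion.2 ⟨(⟨a + 1, ha⟩, j), μ, x, y, hx, hy, hxi, hxj, hyi,
            hyj, ?_, exists_band_ne_zero h3 hx' hy' (ne_zero_of_apply_eq_one hxi)
            (ne_zero_of_apply_eq_one hyj), by rw [hxi]; exact one_ne_zero⟩))
          exact fun w hw => eq_zero_of_pivots (by omega) hx' hy' hxi hxj hyi hyj hw
        · push Not at h2
          refine Or.inl ⟨μ, hμ.trans (Submodule.finrank_mono fun w hw => ⟨fun l hl => ?_,
            fun l hl => hw.2 l (by omega)⟩)⟩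
          rcases Nat.lt_succ_iff_lt_or_eq.1 hl with hl | hl
          · exact hw.1 l hl
          · have : l = ⟨a + 1, ha⟩ := Fin.ext hl
            exact this ▸ h2 w hw
      refine (dimH_mono hsub).trans ?_
      rw [dimH_union, dimH_union, dimH_iUnion]
      exact max_le (ih (a + 1) (by omega)) (max_le (dimH_farPair_le hk _)
        (iSup_le fun r => dimH_doubleTail_pivot_le hk ha r.1 r.2))
    · have : {A : bandedSymm n k |
          ∃ μ : ℝ, 2 ≤ finrank ℝ (tailKer a (a + 1) (A.1 - μ • 1))} = ∅ := by
        refine eq_empty_iff_forall_notMem.2 ?_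
        rintro A ⟨μ, hμ⟩
        rw [hbot _ _ _ (by omega)] at hμ
        omega
      rw [this, dimH_empty]
      exact zero_le

end TailKernel

/-! ### Two distinct multiple eigenvalues, and the exceptional set -/

section TwoEigenvalues

variable {n k : ℕ}

theorem dotProduct_self_ne_zero {x : Fin n → ℝ} (hx : x ≠ 0) : x ⬝ᵥ x ≠ 0 := fun h =>
  hx (dotProduct_self_eq_zero.1 h)

theorem dotProduct_combination_mulVec (c₁ c₂ c₃ : ℝ) (H₁ H₂ H₃ : bandedSymm n k)
    (x y : Fin n → ℝ) :
    x ⬝ᵥ (c₁ • H₁ + c₂ • H₂ + c₃ • H₃).1.mulVec y =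
      c₁ * (x ⬝ᵥ H₁.1.mulVec y) + c₂ * (x ⬝ᵥ H₂.1.mulVec y) + c₃ * (x ⬝ᵥ H₃.1.mulVec y) := by
  change x ⬝ᵥ (c₁ • H₁.1 + c₂ • H₂.1 + c₃ • H₃.1).mulVec y = _
  simp only [Matrix.add_mulVec, Matrix.smul_mulVec, dotProduct_add, dotProduct_smul, smul_eq_mul]

/-- Transversality of two double eigenvalues: three of the four linear conditions that keep both
of them double are independent. -/
theorem exists_three_independent_of_orthogonal (A : bandedSymm n k) {μ ν : ℝ} (hμν : μ ≠ ν)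
    {o : Fin n} {x y u v : Fin n → ℝ} (hAy : A.1.mulVec y = μ • y) (hAv : A.1.mulVec v = ν • v)
    (hxo : x o = 0) (hyo : y o = 1) (huo : u o = 0) (hvo : v o = 1) (hx : x ≠ 0) (hu : u ≠ 0)
    (hxy : ∃ p q : Fin n, ((q : ℤ) - (p : ℤ)).natAbs ≤ k ∧ x p * y q + x q * y p ≠ 0)
    (huv : ∃ p q : Fin n, ((q : ℤ) - (p : ℤ)).natAbs ≤ k ∧ u p * v q + u q * v p ≠ 0) :
    ∃ H₁ H₂ H₃ : bandedSymm n k, ∀ c₁ c₂ c₃ : ℝ,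
      x ⬝ᵥ (c₁ • H₁ + c₂ • H₂ + c₃ • H₃).1.mulVec y = 0 →
      y ⬝ᵥ y * (x ⬝ᵥ (c₁ • H₁ + c₂ • H₂ + c₃ • H₃).1.mulVec x) =
        x ⬝ᵥ x * (y ⬝ᵥ (c₁ • H₁ + c₂ • H₂ + c₃ • H₃).1.mulVec y) →
      u ⬝ᵥ (c₁ • H₁ + c₂ • H₂ + c₃ • H₃).1.mulVec v = 0 →
      v ⬝ᵥ v * (u ⬝ᵥ (c₁ • H₁ + c₂ • H₂ + c₃ • H₃).1.mulVec u) =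
        u ⬝ᵥ u * (v ⬝ᵥ (c₁ • H₁ + c₂ • H₂ + c₃ • H₃).1.mulVec v) →
      c₁ = 0 ∧ c₂ = 0 ∧ c₃ = 0 := by
  by_contra! hcon
  obtain ⟨p, q, hpq, hpq0⟩ := hxy
  obtain ⟨p', q', hpq', hpq0'⟩ := huv
  have hxx := dotProduct_self_ne_zero hx
  have huu := dotProduct_self_ne_zero hu
  -- The two conditions for `μ` are already independent on `H₁` and `H₂`. If no third direction
  -- helps, the conditions for `ν` depend on those for `μ`; `key` records this dependence.
  let H₁ : bandedSymm n k := bandUnit o o (by simp)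
  let H₂ : bandedSymm n k := bandUnit p q hpq
  have hunit : ∀ (l m : Fin n) (h : ((m : ℤ) - (l : ℤ)).natAbs ≤ k) (r s : Fin n → ℝ),
      r ⬝ᵥ (bandUnit l m h).1.mulVec s = r l * s m + r m * s l := fun l m h =>
    dotProduct_symUnit_mulVec l m
  set κ : ℝ := (u p * v q + u q * v p) / (x p * y q + x q * y p) with hκ
  have key : ∀ H : bandedSymm n k, u ⬝ᵥ H.1.mulVec v = κ * (x ⬝ᵥ H.1.mulVec y) ∧
      (x ⬝ᵥ H.1.mulVec y = 0 → u ⬝ᵥ u * (y ⬝ᵥ y * (x ⬝ᵥ H.1.mulVec x) -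
        x ⬝ᵥ x * (y ⬝ᵥ H.1.mulVec y)) = x ⬝ᵥ x * (v ⬝ᵥ v * (u ⬝ᵥ H.1.mulVec u) -
        u ⬝ᵥ u * (v ⬝ᵥ H.1.mulVec v))) := by
    intro H
    obtain ⟨c₁, c₂, c₃, e₁, e₂, e₃, e₄, hc⟩ := hcon H₁ H₂ H
    simp only [dotProduct_combination_mulVec, H₁, H₂, hunit, hxo, hyo, huo, hvo] at e₁ e₂ e₃ e₄
    have hc₃ : c₃ ≠ 0 := by
      intro h0
      have h2 : c₂ = 0 := by
        have : c₂ * (x p * y q + x q * y p) = 0 := by rw [h0] at e₁; linarith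
        exact (mul_eq_zero.1 this).resolve_right hpq0
      have h1 : c₁ = 0 := by
        have : c₁ * (x ⬝ᵥ x) = 0 := by rw [h0, h2] at e₂; linarith
        exact (mul_eq_zero.1 this).resolve_right hxx
      exact hc h1 h2 h0
    have hκ' : u p * v q + u q * v p = κ * (x p * y q + x q * y p) := by
      rw [hκ, div_mul_cancel₀ _ hpq0]
    refine ⟨?_, fun ha => ?_⟩
    · refine mul_left_cancel₀ hc₃ ?_
      linear_combination e₃ - κ * e₁ - c₂ * hκ'
    · have h2 : c₂ = 0 := by
        have : c₂ * (x p * y q + x q * y p) = 0 := by rw [ha] at e₁; linarith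
        exact (mul_eq_zero.1 this).resolve_right hpq0
      subst h2
      refine mul_left_cancel₀ hc₃ ?_
      linear_combination (u ⬝ᵥ u) * e₂ - (x ⬝ᵥ x) * e₄
  have hκ0 : κ ≠ 0 := by
    intro h0
    have := (key (bandUnit p' q' hpq')).1
    rw [h0, zero_mul, hunit] at this
    exact hpq0' this
  -- Testing `key` on the units at `(o, l)` and `(l, l)` identifies `y` and `v` wherever row `o` of
  -- `A` can be nonzero. As `y o = v o = 1`, that row yields `μ = ν`.
  have hyv : ∀ l : Fin n, ((l : ℤ) - (o : ℤ)).natAbs ≤ k → y l = v l := by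
    intro l hl
    have h1 := key (bandUnit o l hl)
    have h2 := (key (bandUnit l l (by simp))).1
    simp only [hunit, hxo, hyo, huo, hvo] at h1 h2
    by_cases hxl : x l = 0
    · have h3 := h1.2 (by rw [hxl]; ring)
      have hul : u l = 0 := by rw [hxl] at h1; linarith [h1.1]
      rw [hxl, hul] at h3
      have h4 : (x ⬝ᵥ x) * (u ⬝ᵥ u) * y l = (x ⬝ᵥ x) * (u ⬝ᵥ u) * v l := by linarith
      exact mul_left_cancel₀ (mul_ne_zero hxx huu) h4
    · have hul : u l = κ * x l := by linarith [h1.1]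
      rw [hul] at h2
      have h4 : (κ * x l) * y l = (κ * x l) * v l := by linarith
      exact mul_left_cancel₀ (mul_ne_zero hκ0 hxl) h4
  have hrow : A.1.mulVec y o = A.1.mulVec v o := by
    change ∑ l, A.1 o l * y l = ∑ l, A.1 o l * v l
    refine Finset.sum_congr rfl fun l _ => ?_
    rcases le_or_gt ((l : ℤ) - (o : ℤ)).natAbs k with hl | hl
    · rw [hyv l hl]
    · rw [apply_eq_zero_of_mem A.2 hl, zero_mul, zero_mul]
  rw [hAy, hAv] at hrow
  simp only [Pi.smul_apply, hyo, hvo, smul_eq_mul, mul_one] at hrow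
  exact hμν hrow

theorem exists_orthogonal_correction {M : Submodule ℝ (Fin n → ℝ)} {x y : Fin n → ℝ} {o : Fin n}
    (hx : x ∈ M) (hy : y ∈ M) (hx0 : x ≠ 0) (hxo : x o = 0) (hyo : y o = 1) :
    ∃ z ∈ M, x ⬝ᵥ z = 0 ∧ z o = 1 := by
  refine ⟨y - (x ⬝ᵥ y / x ⬝ᵥ x) • x, M.sub_mem hy (M.smul_mem _ hx), ?_, ?_⟩
  · rw [dotProduct_sub, dotProduct_smul, smul_eq_mul,
      div_mul_cancel₀ _ (dotProduct_self_ne_zero hx0), sub_self]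
  · simp [hxo, hyo]

/-- To first order, an eigenvalue stays double if `H` compresses to a scalar on its eigenspace. In
an orthogonal basis, eliminating the scalars `s` and `t` leaves the four equations of
`exists_three_independent_of_orthogonal`. -/
theorem exists_three_independent (A : bandedSymm n k) {μ ν : ℝ} (hμν : μ ≠ ν)
    {o : Fin n} {x y u v : Fin n → ℝ}
    (hx : x ∈ tailKer 0 0 (A.1 - μ • 1)) (hy : y ∈ tailKer 0 0 (A.1 - μ • 1))
    (hu : u ∈ tailKer 0 0 (A.1 - ν • 1)) (hv : v ∈ tailKer 0 0 (A.1 - ν • 1))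
    (hxo : x o = 0) (hyo : y o = 1) (huo : u o = 0) (hvo : v o = 1) (hx0 : x ≠ 0) (hu0 : u ≠ 0)
    (hμ : ¬HasFarPair k 0 (A.1 - μ • 1)) (hν : ¬HasFarPair k 0 (A.1 - ν • 1)) :
    ∃ H₁ H₂ H₃ : bandedSymm n k, ∀ c₁ c₂ c₃ s t : ℝ,
      (∀ w ∈ tailKer 0 0 (A.1 - μ • 1), ∀ z ∈ tailKer 0 0 (A.1 - μ • 1),
        w ⬝ᵥ (c₁ • H₁ + c₂ • H₂ + c₃ • H₃).1.mulVec z = s * (w ⬝ᵥ z)) →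
      (∀ w ∈ tailKer 0 0 (A.1 - ν • 1), ∀ z ∈ tailKer 0 0 (A.1 - ν • 1),
        w ⬝ᵥ (c₁ • H₁ + c₂ • H₂ + c₃ • H₃).1.mulVec z = t * (w ⬝ᵥ z)) →
      c₁ = 0 ∧ c₂ = 0 ∧ c₃ = 0 := by
  obtain ⟨y', hy', hxy', hyo'⟩ := exists_orthogonal_correction hx hy hx0 hxo hyo
  obtain ⟨v', hv', huv', hvo'⟩ := exists_orthogonal_correction hu hv hu0 huo hvo
  obtain ⟨H₁, H₂, H₃, h⟩ := exists_three_independent_of_orthogonal A hμν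
    (mem_tailKer_zero_zero.1 hy') (mem_tailKer_zero_zero.1 hv') hxo hyo' huo hvo' hx0 hu0
    (exists_band_ne_zero hμ hx hy' hx0 (ne_zero_of_apply_eq_one hyo'))
    (exists_band_ne_zero hν hu hv' hu0 (ne_zero_of_apply_eq_one hvo'))
  refine ⟨H₁, H₂, H₃, fun c₁ c₂ c₃ s t hs ht => h c₁ c₂ c₃ ?_ ?_ ?_ ?_⟩
  · rw [hs x hx y' hy', hxy', mul_zero]
  · rw [hs x hx x hx, hs y' hy' y' hy']; ring
  · rw [ht u hu v' hv', huv', mul_zero]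
  · rw [ht u hu u hu, ht v' hv' v' hv']; ring

/-- There are `N + 2 + 4n` unknowns. The equations are injective on the four vectors, the two
eigenvalues and three matrix directions, in all `4n + 5`. -/
theorem dimH_twoEigenvalues_pivot_le (o : Fin n) (j : Fin 2 → Fin n) :
    dimH {A : bandedSymm n k | ∃ (μ : Fin 2 → ℝ) (v : Fin 2 × Fin 2 → Fin n → ℝ), μ 0 ≠ μ 1 ∧
      (∀ e, finrank ℝ (tailKer 0 0 (A.1 - μ e • 1)) ≤ 2) ∧
      (∀ e f, v (e, f) ∈ tailKer 0 0 (A.1 - μ e • 1)) ∧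
      (∀ e, v (e, 0) o = 1 ∧ v (e, 0) (j e) = 0 ∧ v (e, 1) o = 0 ∧ v (e, 1) (j e) = 1) ∧
      ∀ e, ¬HasFarPair k 0 (A.1 - μ e • 1)} ≤
      ((finrank ℝ (bandedSymm n k) - 3 : ℕ) : ℝ≥0∞) := by
  classical
  refine dimH_le_of_eigenvector_incidence
    (Z := (Fin 2 × Fin 2 → Fin n → ℝ) × (Fin 2 → ℝ) × ℝ × ℝ × ℝ) 0
    (E := Fin 2) (ι := Fin 2 × Fin 2) Prod.fst (fun i => {l | l = o ∨ l = j i.1})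
    (fun i => if i.2 = 0 then Pi.single o 1 else Pi.single (j i.1) 1) _ ?_ ?_
  · simp only [Fintype.card_fin, Fintype.card_prod, finrank_prod, finrank_self, finrank_pi_fintype,
      Finset.sum_const, Finset.card_univ, smul_eq_mul]
    omega
  rintro A ⟨μ, v, hμ, hrank, hv, hpiv, hfar⟩
  obtain ⟨H₁, H₂, H₃, hH⟩ := exists_three_independent A hμ (hv 0 1) (hv 0 0) (hv 1 1) (hv 1 0)
    (hpiv 0).2.2.1 (hpiv 0).1 (hpiv 1).2.2.1 (hpiv 1).1
    (ne_zero_of_apply_eq_one (hpiv 0).2.2.2) (ne_zero_of_apply_eq_one (hpiv 1).2.2.2)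
    (hfar 0) (hfar 1)
  have hoj : ∀ e, o ≠ j e := fun e h => by
    have h1 := (hpiv e).1
    rw [h, (hpiv e).2.1] at h1
    exact zero_ne_one h1
  have hfull : ∀ e, ∀ w ∈ tailKer 0 0 (A.1 - μ e • 1), w o = 0 → w (j e) = 0 → w = 0 :=
    fun e w hw => eq_zero_of_pivots (hrank e) (hv e 0) (hv e 1) (hpiv e).1 (hpiv e).2.1
      (hpiv e).2.2.1 (hpiv e).2.2.2 hw
  let J : ((Fin 2 × Fin 2 → Fin n → ℝ) × (Fin 2 → ℝ) × ℝ × ℝ × ℝ) →ₗ[ℝ]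
      bandedSymm n k × (Fin 2 → ℝ) × (Fin 2 × Fin 2 → Fin n → ℝ) :=
    { toFun := fun z => (z.2.2.1 • H₁ + z.2.2.2.1 • H₂ + z.2.2.2.2 • H₃, z.2.1, z.1)
      map_add' := by
        intro z w
        refine Prod.ext ?_ (Prod.ext rfl rfl)
        simp only [Prod.fst_add, Prod.snd_add, add_smul]
        abel
      map_smul' := by
        intro r z
        refine Prod.ext ?_ (Prod.ext rfl rfl)
        simp only [Prod.smul_fst, Prod.smul_snd, smul_add, smul_assoc, RingHom.id_apply] }
  refine ⟨μ, v, fun i l hl => (mem_tailKer_sub_smul.1 (hv i.1 i.2)).2 l hl, ?_, J, ?_⟩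
  · rintro ⟨e, f⟩ l (rfl | rfl)
    · fin_cases f
      · simpa using (hpiv e).1
      · simpa [hoj e] using (hpiv e).2.2.1
    · fin_cases f
      · simpa [(hoj e).symm] using (hpiv e).2.1
      · simpa using (hpiv e).2.2.2
  rintro ⟨w, s, c₁, c₂, c₃⟩ h1 h2
  set H : bandedSymm n k := c₁ • H₁ + c₂ • H₂ + c₃ • H₃ with hHdef
  have hlin : ∀ e f l, (A.1 - μ e • 1).mulVec (w (e, f)) l +
      (H.1 - s e • 1).mulVec (v (e, f)) l = 0 := by
    intro e f l
    have h3 : A.1.mulVec (w (e, f)) l + H.1.mulVec (v (e, f)) l =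
        μ e * w (e, f) l + s e * v (e, f) l := h1 (e, f) l (Nat.zero_le _)
    simp only [sub_smul_one_mulVec, Pi.sub_apply, Pi.smul_apply, smul_eq_mul]
    linarith
  have hdot : ∀ e, ∀ a ∈ tailKer 0 0 (A.1 - μ e • 1), ∀ b ∈ tailKer 0 0 (A.1 - μ e • 1),
      a ⬝ᵥ H.1.mulVec b = s e * (a ⬝ᵥ b) := by
    intro e a ha b hb
    have h4 : ∀ f, a ⬝ᵥ (H.1 - s e • 1).mulVec (v (e, f)) = 0 := fun f =>
      dotProduct_mulVec_eq_zero_of_linearized (sub_smul_one_isSymm A (μ e)) ha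
        (fun l hl => absurd hl (Nat.not_lt_zero _)) fun l _ => hlin e f l
    have h5 := eq_smul_add_smul_of_pivots (hfull e) (hv e 0) (hv e 1) (hpiv e).1 (hpiv e).2.1
      (hpiv e).2.2.1 (hpiv e).2.2.2 hb
    have h6 : a ⬝ᵥ (H.1 - s e • 1).mulVec b = 0 := by
      rw [h5, Matrix.mulVec_add, Matrix.mulVec_smul, Matrix.mulVec_smul, dotProduct_add,
        dotProduct_smul, dotProduct_smul, h4, h4, smul_zero, smul_zero, add_zero]
    rw [sub_smul_one_mulVec, dotProduct_sub, dotProduct_smul, smul_eq_mul] at h6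
    linarith
  obtain ⟨rfl, rfl, rfl⟩ := hH c₁ c₂ c₃ (s 0) (s 1) (hdot 0) (hdot 1)
  have hH0 : H = 0 := by simp [hHdef]
  have hs : s = 0 := by
    funext e
    have h3 := hdot e _ (hv e 0) _ (hv e 0)
    rw [hH0] at h3
    simp only [ZeroMemClass.coe_zero, Matrix.zero_mulVec, dotProduct_zero] at h3
    exact (mul_eq_zero.1 h3.symm).resolve_right
      (dotProduct_self_ne_zero (ne_zero_of_apply_eq_one (hpiv e).1))
  have hw : w = 0 := by
    funext i
    refine hfull i.1 _ ⟨fun l hl => absurd hl (Nat.not_lt_zero _), fun l _ => ?_⟩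
      (h2 i o (Or.inl rfl)) (h2 i (j i.1) (Or.inr rfl))
    have h3 := hlin i.1 i.2 l
    rw [hH0, hs] at h3
    simpa using h3
  simp [hw, hs]

/-- Matrices with two distinct multiple eigenvalues, or with an eigenvalue that is multiple in a
degenerate way. -/
theorem dimH_exceptional_le (hk : 0 < k) (hn : 0 < n) :
    dimH {A : bandedSymm n k |
      (∃ μ : ℝ, 3 ≤ finrank ℝ (tailKer 0 0 (A.1 - μ • 1))) ∨
      (∃ μ : ℝ, HasFarPair k 0 (A.1 - μ • 1)) ∨
      ∃ μ ν : ℝ, μ ≠ ν ∧ 2 ≤ finrank ℝ (tailKer 0 0 (A.1 - μ • 1)) ∧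
        2 ≤ finrank ℝ (tailKer 0 0 (A.1 - ν • 1))} ≤
      ((finrank ℝ (bandedSymm n k) - 3 : ℕ) : ℝ≥0∞) := by
  let o : Fin n := ⟨0, hn⟩
  let S : (Fin 2 → Fin n) → Set (bandedSymm n k) := fun j =>
    {A | ∃ (μ : Fin 2 → ℝ) (v : Fin 2 × Fin 2 → Fin n → ℝ), μ 0 ≠ μ 1 ∧
      (∀ e, finrank ℝ (tailKer 0 0 (A.1 - μ e • 1)) ≤ 2) ∧
      (∀ e f, v (e, f) ∈ tailKer 0 0 (A.1 - μ e • 1)) ∧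
      (∀ e, v (e, 0) o = 1 ∧ v (e, 0) (j e) = 0 ∧ v (e, 1) o = 0 ∧ v (e, 1) (j e) = 1) ∧
      ∀ e, ¬HasFarPair k 0 (A.1 - μ e • 1)}
  -- The first set absorbs the triple eigenvalues. Outside it every multiple eigenspace has a vector
  -- nonzero at `o`, so both eigenvalues can use the common pivot `o` that transversality needs.
  refine (dimH_mono (t := {A : bandedSymm n k | ∃ μ : ℝ,
      2 ≤ finrank ℝ (tailKer 0 (0 + 1) (A.1 - μ • 1))} ∪
      ({A | ∃ μ : ℝ, HasFarPair k 0 (A.1 - μ • 1)} ∪ ⋃ j, S j)) ?_).trans ?_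
  · intro A hA
    by_cases h1 : ∃ μ : ℝ, 2 ≤ finrank ℝ (tailKer 0 (0 + 1) (A.1 - μ • 1))
    · exact Or.inl h1
    by_cases h2 : ∃ μ : ℝ, HasFarPair k 0 (A.1 - μ • 1)
    · exact Or.inr (Or.inl h2)
    push Not at h1 h2
    rcases hA with ⟨μ, hμ⟩ | hA | ⟨μ, ν, hμν, hμ, hν⟩
    · have h3 := finrank_tailKer_le_succ 0 (A.1 - μ • 1)
      have h4 := h1 μ
      omega
    · exact absurd hA (by simpa using h2)
    · refine Or.inr (Or.inr ?_)
      have hpiv : ∀ e : Fin 2, ∃ j, ∃ x ∈ tailKer 0 0 (A.1 - (![μ, ν] : Fin 2 → ℝ) e • 1),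
          ∃ y ∈ tailKer 0 0 (A.1 - (![μ, ν] : Fin 2 → ℝ) e • 1),
          x o = 1 ∧ x j = 0 ∧ y o = 0 ∧ y j = 1 := by
        intro e
        have hrk : 2 ≤ finrank ℝ (tailKer 0 0 (A.1 - (![μ, ν] : Fin 2 → ℝ) e • 1)) := by
          fin_cases e
          · exact hμ
          · exact hν
        by_cases h3 : ∃ v ∈ tailKer 0 0 (A.1 - (![μ, ν] : Fin 2 → ℝ) e • 1), v o ≠ 0
        · obtain ⟨v, hv, hvo⟩ := h3
          exact exists_pivots_of_apply_ne_zero hrk hv hvo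
        · push Not at h3
          have hle : tailKer 0 0 (A.1 - (![μ, ν] : Fin 2 → ℝ) e • 1) ≤
              tailKer 0 (0 + 1) (A.1 - (![μ, ν] : Fin 2 → ℝ) e • 1) := by
            intro w hw
            refine ⟨fun l hl => ?_, hw.2⟩
            have : l = o := Fin.ext (Nat.lt_one_iff.1 hl)
            exact this ▸ h3 w hw
          have h4 := Submodule.finrank_mono hle
          have h5 := h1 ((![μ, ν] : Fin 2 → ℝ) e)
          omega
      choose j x hx y hy h using hpiv
      refine mem_iUnion.2 ⟨j, ![μ, ν], fun i => if i.2 = 0 then x i.1 else y i.1, hμν,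
        fun e => ?_, fun e f => ?_, fun e => by simpa using h e, fun e => h2 _⟩
      · have h3 := finrank_tailKer_le_succ 0 (A.1 - (![μ, ν] : Fin 2 → ℝ) e • 1)
        have h4 := h1 ((![μ, ν] : Fin 2 → ℝ) e)
        omega
      · fin_cases f
        · exact hx e
        · exact hy e
  · rw [dimH_union, dimH_union, dimH_iUnion]
    exact max_le (dimH_doubleTail_le hk 0) (max_le (dimH_farPair_le hk 0)
      (iSup_le fun j => dimH_twoEigenvalues_pivot_le o j))

end TwoEigenvalues

/-! ### Analytic continuation of a double eigenspace, and localisation of multiple eigenvalues -/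

section SmoothPart

variable {n k : ℕ}

/-- Multiplication of a vector by `A - μ`, as a linear function of `(A, μ)`. -/
noncomputable def shiftMulVec (n k : ℕ) :
    (bandedSymm n k × ℝ) →L[ℝ] (Fin n → ℝ) →L[ℝ] (Fin n → ℝ) :=
  (bandedMulVec n k).comp (ContinuousLinearMap.fst ℝ _ _) -
    (ContinuousLinearMap.snd ℝ (bandedSymm n k) ℝ).smulRight (ContinuousLinearMap.id ℝ (Fin n → ℝ))

theorem shiftMulVec_apply (z : bandedSymm n k × ℝ) (w : Fin n → ℝ) :
    shiftMulVec n k z w = (z.1.1 - z.2 • 1).mulVec w := by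
  rw [sub_smul_one_mulVec]
  rfl

/-- The dot product as a continuous bilinear map. -/
noncomputable def dotProductCLM (n : ℕ) : (Fin n → ℝ) →L[ℝ] (Fin n → ℝ) →L[ℝ] ℝ :=
  LinearMap.toContinuousLinearMap
    ((LinearMap.toContinuousLinearMap (𝕜 := ℝ) (E := Fin n → ℝ) (F' := ℝ)).toLinearMap ∘ₗ
      dotProductBilin ℝ ℝ (m := Fin n) (A := ℝ))

@[simp] theorem dotProductCLM_apply (x y : Fin n → ℝ) : dotProductCLM n x y = x ⬝ᵥ y := rfl

open Classical in
/-- The projection that forgets the coordinates `i` and `j`. -/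
noncomputable def forgetPair (i j : Fin n) : (Fin n → ℝ) →L[ℝ] (Fin n → ℝ) :=
  ContinuousLinearMap.pi fun l => if l = i ∨ l = j then 0 else ContinuousLinearMap.proj l

theorem forgetPair_apply_of_eq {i j l : Fin n} (h : l = i ∨ l = j) (w : Fin n → ℝ) :
    forgetPair i j w l = 0 := by
  simp [forgetPair, h]

theorem forgetPair_apply_of_ne {i j l : Fin n} (h : ¬(l = i ∨ l = j)) (w : Fin n → ℝ) :
    forgetPair i j w l = w l := by
  simp [forgetPair, h]

/-- The linear system whose solutions continue the kernel vectors of `A - μ` in reduced form. -/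
noncomputable def pivotSystem (i j : Fin n) (z : bandedSymm n k × ℝ) :
    (Fin n → ℝ) →L[ℝ] (Fin n → ℝ) :=
  (forgetPair i j).comp (shiftMulVec n k z) + (ContinuousLinearMap.id ℝ _ - forgetPair i j)

theorem pivotSystem_apply_of_eq {i j l : Fin n} (h : l = i ∨ l = j) (z : bandedSymm n k × ℝ)
    (w : Fin n → ℝ) : pivotSystem i j z w l = w l := by
  change forgetPair i j (shiftMulVec n k z w) l + (w l - forgetPair i j w l) = _
  rw [forgetPair_apply_of_eq h, forgetPair_apply_of_eq h, zero_add, sub_zero]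

theorem pivotSystem_apply_of_ne {i j l : Fin n} (h : ¬(l = i ∨ l = j)) (z : bandedSymm n k × ℝ)
    (w : Fin n → ℝ) : pivotSystem i j z w l = shiftMulVec n k z w l := by
  change forgetPair i j (shiftMulVec n k z w) l + (w l - forgetPair i j w l) = _
  rw [forgetPair_apply_of_ne h, forgetPair_apply_of_ne h, sub_self, add_zero]

theorem contDiff_pivotSystem (i j : Fin n) :
    ContDiff ℝ ω (pivotSystem i j : bandedSymm n k × ℝ → _) :=
  (contDiff_const.clm_comp (shiftMulVec n k).contDiff).add contDiff_const

/-- A reduced basis of the eigenspace for a double eigenvalue extends to analytic families that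
contain every nearby double eigenspace. -/
theorem exists_analytic_pivots {z₀ : bandedSymm n k × ℝ} {i j : Fin n} {x y : Fin n → ℝ}
    (hx : x ∈ tailKer 0 0 (z₀.1.1 - z₀.2 • 1)) (hy : y ∈ tailKer 0 0 (z₀.1.1 - z₀.2 • 1))
    (hxi : x i = 1) (hxj : x j = 0) (hyi : y i = 0) (hyj : y j = 1)
    (hfull : ∀ w ∈ tailKer 0 0 (z₀.1.1 - z₀.2 • 1), w i = 0 → w j = 0 → w = 0) :
    ∃ X Y : bandedSymm n k × ℝ → Fin n → ℝ, ContDiffAt ℝ ω X z₀ ∧ ContDiffAt ℝ ω Y z₀ ∧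
      X z₀ = x ∧ Y z₀ = y ∧ ∀ᶠ z in 𝓝 z₀, X z i = 1 ∧ X z j = 0 ∧ Y z i = 0 ∧ Y z j = 1 ∧
        (∀ l, ¬(l = i ∨ l = j) → (z.1.1 - z.2 • 1).mulVec (X z) l = 0) ∧
        (∀ l, ¬(l = i ∨ l = j) → (z.1.1 - z.2 • 1).mulVec (Y z) l = 0) ∧
        ∀ w ∈ tailKer 0 0 (z.1.1 - z.2 • 1), w = w i • X z + w j • Y z := by
  have hij : i ≠ j := by rintro rfl; rw [hxi] at hxj; exact one_ne_zero hxj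
  have hsym : (z₀.1.1 - z₀.2 • (1 : Matrix (Fin n) (Fin n) ℝ)).IsSymm :=
    sub_smul_one_isSymm z₀.1 z₀.2
  -- If `w` is killed, `(A - μ)w` is supported on `{i, j}`. By symmetry it is orthogonal to `x` and
  -- `y`, which are reduced at `i`, `j`, so it vanishes; then `hfull` applies.
  have hinj : Function.Injective (pivotSystem i j z₀) := by
    refine (injective_iff_map_eq_zero _).2 fun w hw => ?_
    have hwi : w i = 0 := by rw [← pivotSystem_apply_of_eq (Or.inl rfl) z₀ w, hw]; rfl
    have hwj : w j = 0 := by rw [← pivotSystem_apply_of_eq (Or.inr rfl) z₀ w, hw]; rfl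
    have hrow : ∀ l, ¬(l = i ∨ l = j) → (z₀.1.1 - z₀.2 • 1).mulVec w l = 0 := fun l hl => by
      rw [← shiftMulVec_apply, ← pivotSystem_apply_of_ne hl, hw]; rfl
    refine hfull w ⟨fun l hl => absurd hl (Nat.not_lt_zero _), fun l _ => ?_⟩ hwi hwj
    have hpair : ∀ u : Fin n → ℝ, u ⬝ᵥ (z₀.1.1 - z₀.2 • 1).mulVec w =
        u i * (z₀.1.1 - z₀.2 • 1).mulVec w i + u j * (z₀.1.1 - z₀.2 • 1).mulVec w j := by
      intro u
      refine Fintype.sum_eq_add i j hij fun l hl => ?_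
      rw [hrow l (by tauto), mul_zero]
    have h0 : ∀ u ∈ tailKer 0 0 (z₀.1.1 - z₀.2 • (1 : Matrix (Fin n) (Fin n) ℝ)),
        u ⬝ᵥ (z₀.1.1 - z₀.2 • 1).mulVec w = 0 := fun u hu =>
      dotProduct_mulVec_eq_zero_of_mem_tailKer hsym hu fun l hl => absurd hl (Nat.not_lt_zero _)
    have h1 := h0 x hx
    have h2 := h0 y hy
    rw [hpair, hxi, hxj] at h1
    rw [hpair, hyi, hyj] at h2
    by_cases hl : l = i ∨ l = j
    · rcases hl with rfl | rfl
      · linarith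
      · linarith
    · exact hrow l hl
  let e : (Fin n → ℝ) ≃L[ℝ] (Fin n → ℝ) :=
    (LinearEquiv.ofInjectiveEndo (pivotSystem i j z₀ : (Fin n → ℝ) →ₗ[ℝ] (Fin n → ℝ))
      hinj).toContinuousLinearEquiv
  have he : (e : (Fin n → ℝ) →L[ℝ] (Fin n → ℝ)) = pivotSystem i j z₀ := by
    ext w l
    rfl
  have hcont : ContDiffAt ℝ ω (fun z : bandedSymm n k × ℝ => (pivotSystem i j z).inverse) z₀ := by
    have h1 : ContDiffAt ℝ ω ContinuousLinearMap.inverse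
        (pivotSystem i j z₀ : (Fin n → ℝ) →L[ℝ] (Fin n → ℝ)) :=
      he ▸ contDiffAt_map_inverse e
    exact h1.comp z₀ (contDiff_pivotSystem i j).contDiffAt
  -- The right-hand side prescribes the pivot entries `(1, 0)` and makes `(A - μ)X` vanish outside
  -- the rows `i`, `j`.
  let X : bandedSymm n k × ℝ → Fin n → ℝ := fun z => (pivotSystem i j z).inverse (Pi.single i 1)
  let Y : bandedSymm n k × ℝ → Fin n → ℝ := fun z => (pivotSystem i j z).inverse (Pi.single j 1)
  have hev : ∀ᶠ z in 𝓝 z₀, X z i = 1 ∧ X z j = 0 ∧ Y z i = 0 ∧ Y z j = 1 ∧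
        (∀ l, ¬(l = i ∨ l = j) → (z.1.1 - z.2 • 1).mulVec (X z) l = 0) ∧
        (∀ l, ¬(l = i ∨ l = j) → (z.1.1 - z.2 • 1).mulVec (Y z) l = 0) ∧
        ∀ w ∈ tailKer 0 0 (z.1.1 - z.2 • 1), w = w i • X z + w j • Y z := by
    have hnhds : ∀ᶠ z in 𝓝 z₀, pivotSystem i j z ∈
        range ((↑) : ((Fin n → ℝ) ≃L[ℝ] (Fin n → ℝ)) → (Fin n → ℝ) →L[ℝ] (Fin n → ℝ)) := by
      refine (contDiff_pivotSystem i j).continuous.continuousAt.eventually ?_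
      rw [← he]
      exact ContinuousLinearEquiv.nhds e
    filter_upwards [hnhds]
    rintro z ⟨e', he'⟩
    have hinv : ∀ v, pivotSystem i j z ((pivotSystem i j z).inverse v) = v := by
      intro v
      rw [← he', ContinuousLinearMap.inverse_equiv]
      exact e'.apply_symm_apply v
    have hX := hinv (Pi.single i 1)
    have hY := hinv (Pi.single j 1)
    have hXl : ∀ l, (Pi.single i 1 : Fin n → ℝ) l = pivotSystem i j z (X z) l :=
      fun l => (congrFun hX l).symm
    have hYl : ∀ l, (Pi.single j 1 : Fin n → ℝ) l = pivotSystem i j z (Y z) l :=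
      fun l => (congrFun hY l).symm
    refine ⟨?_, ?_, ?_, ?_, fun l hl => ?_, fun l hl => ?_, fun w hw => ?_⟩
    · rw [← pivotSystem_apply_of_eq (i := i) (j := j) (Or.inl rfl) z (X z), ← hXl, Pi.single_eq_same]
    · rw [← pivotSystem_apply_of_eq (i := i) (j := j) (Or.inr rfl) z (X z), ← hXl, Pi.single_eq_of_ne hij.symm]
    · rw [← pivotSystem_apply_of_eq (i := i) (j := j) (Or.inl rfl) z (Y z), ← hYl, Pi.single_eq_of_ne hij]
    · rw [← pivotSystem_apply_of_eq (i := i) (j := j) (Or.inr rfl) z (Y z), ← hYl, Pi.single_eq_same]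
    · rw [← shiftMulVec_apply, ← pivotSystem_apply_of_ne hl, ← hXl,
        Pi.single_eq_of_ne (fun h => hl (Or.inl h))]
    · rw [← shiftMulVec_apply, ← pivotSystem_apply_of_ne hl, ← hYl,
        Pi.single_eq_of_ne (fun h => hl (Or.inr h))]
    · have hinj' : Function.Injective (pivotSystem i j z) := by
        rw [← he']
        exact e'.injective
      refine hinj' ?_
      have hX' : pivotSystem i j z (X z) = Pi.single i 1 := hX
      have hY' : pivotSystem i j z (Y z) = Pi.single j 1 := hY
      rw [map_add, map_smul, map_smul, hX', hY']
      ext l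
      by_cases hl : l = i ∨ l = j
      · rw [pivotSystem_apply_of_eq hl]
        rcases hl with rfl | rfl
        · simp [hij]
        · simp [hij.symm]
      · rw [pivotSystem_apply_of_ne hl, shiftMulVec_apply, hw.2 l (Nat.zero_le _)]
        push Not at hl
        simp [hl.1, hl.2]
  obtain ⟨-, -, -, -, -, -, hspan⟩ := hev.self_of_nhds
  refine ⟨X, Y, hcont.clm_apply contDiffAt_const, hcont.clm_apply contDiffAt_const, ?_, ?_, hev⟩
  · have := hspan x hx
    rw [hxi, hxj, one_smul, zero_smul, add_zero] at this
    exact this.symm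
  · have := hspan y hy
    rw [hyi, hyj, one_smul, zero_smul, zero_add] at this
    exact this.symm

theorem exists_orthonormal_pair {K : Submodule ℝ (Fin n → ℝ)} (hK : 2 ≤ finrank ℝ K) :
    ∃ u ∈ K, ∃ v ∈ K, u ⬝ᵥ u = 1 ∧ v ⬝ᵥ v = 1 ∧ u ⬝ᵥ v = 0 := by
  obtain ⟨i, j, x, hx, y, hy, hxi, hxj, hyi, hyj⟩ := exists_pivots hK
  have hx0 := ne_zero_of_apply_eq_one hxi
  obtain ⟨z, hz, hxz, hzj⟩ := exists_orthogonal_correction hx hy hx0 hxj hyj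
  have hz0 := ne_zero_of_apply_eq_one hzj
  have hnorm : ∀ w : Fin n → ℝ, w ≠ 0 →
      ((Real.sqrt (w ⬝ᵥ w))⁻¹ • w) ⬝ᵥ ((Real.sqrt (w ⬝ᵥ w))⁻¹ • w) = 1 := by
    intro w hw
    have hpos : 0 ≤ w ⬝ᵥ w := Finset.sum_nonneg fun l _ => mul_self_nonneg _
    have hne := dotProduct_self_ne_zero hw
    rw [smul_dotProduct, dotProduct_smul, smul_eq_mul, smul_eq_mul, ← mul_assoc, ← mul_inv,
      Real.mul_self_sqrt hpos, inv_mul_cancel₀ hne]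
  refine ⟨_, K.smul_mem _ hx, _, K.smul_mem _ hz, hnorm x hx0, hnorm z hz0, ?_⟩
  rw [smul_dotProduct, dotProduct_smul, hxz, smul_zero, smul_zero]

theorem linearIndependent_of_orthonormal_pair {u v : Fin n → ℝ} (hu : u ⬝ᵥ u = 1)
    (hv : v ⬝ᵥ v = 1) (huv : u ⬝ᵥ v = 0) : LinearIndependent ℝ ![u, v] := by
  refine LinearIndependent.pair_iff.2 fun s t h => ⟨?_, ?_⟩
  · have := congrArg (u ⬝ᵥ ·) h
    simpa [dotProduct_add, dotProduct_smul, hu, huv] using this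
  · have := congrArg (v ⬝ᵥ ·) h
    simpa [dotProduct_add, dotProduct_smul, hv, dotProduct_comm v u, huv] using this

theorem norm_le_one_of_dotProduct_self {u : Fin n → ℝ} (hu : u ⬝ᵥ u = 1) : ‖u‖ ≤ 1 := by
  refine (pi_norm_le_iff_of_nonneg zero_le_one).2 fun l => ?_
  have h : u l * u l ≤ u ⬝ᵥ u :=
    Finset.single_le_sum (f := fun l => u l * u l) (fun l _ => mul_self_nonneg _)
      (Finset.mem_univ l)
  rw [hu] at h
  exact abs_le_one_iff_mul_self_le_one.2 h

/-- Near a matrix with a single multiple eigenvalue, all multiple eigenvalues are close to it. -/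
theorem eventually_multiple_eigenvalue_mem {A₀ : bandedSymm n k} {μ₀ : ℝ}
    (huniq : ∀ μ : ℝ, 2 ≤ finrank ℝ (tailKer 0 0 (A₀.1 - μ • 1)) → μ = μ₀)
    {W : Set (bandedSymm n k × ℝ)} (hW : W ∈ 𝓝 (A₀, μ₀)) :
    ∀ᶠ A : bandedSymm n k in 𝓝 A₀, ∀ μ : ℝ, 2 ≤ finrank ℝ (tailKer 0 0 (A.1 - μ • 1)) →
      (A, μ) ∈ W := by
  -- The Rayleigh quotient recovers the eigenvalue, so bad pairs `(A, μ)` are encoded by `A` near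
  -- `A₀` with an orthonormal pair of eigenvectors. They form a compact set `C`, whose projection is
  -- closed and misses `A₀`.
  let q : bandedSymm n k × (Fin n → ℝ) × (Fin n → ℝ) → ℝ := fun p => p.2.1 ⬝ᵥ p.1.1.mulVec p.2.1
  have hA : Continuous fun p : bandedSymm n k × (Fin n → ℝ) × (Fin n → ℝ) => p.1.1 :=
    continuous_subtype_val.comp continuous_fst
  have hu : Continuous fun p : bandedSymm n k × (Fin n → ℝ) × (Fin n → ℝ) => p.2.1 := by fun_prop
  have hv : Continuous fun p : bandedSymm n k × (Fin n → ℝ) × (Fin n → ℝ) => p.2.2 := by fun_prop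
  have hq : Continuous q := hu.dotProduct (hA.matrix_mulVec hu)
  let C : Set (bandedSymm n k × (Fin n → ℝ) × (Fin n → ℝ)) :=
    {p | p.1 ∈ Metric.closedBall A₀ 1} ∩ ({p | p.2.1 ⬝ᵥ p.2.1 = 1} ∩ ({p | p.2.2 ⬝ᵥ p.2.2 = 1} ∩
    ({p | p.2.1 ⬝ᵥ p.2.2 = 0} ∩ ({p | p.1.1.mulVec p.2.1 = q p • p.2.1} ∩
    ({p | p.1.1.mulVec p.2.2 = q p • p.2.2} ∩ {p | (p.1, q p) ∈ (interior W)ᶜ})))))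
  have hC : IsClosed C := by
    refine (Metric.isClosed_closedBall.preimage continuous_fst).inter ?_
    refine (isClosed_eq (hu.dotProduct hu) continuous_const).inter ?_
    refine (isClosed_eq (hv.dotProduct hv) continuous_const).inter ?_
    refine (isClosed_eq (hu.dotProduct hv) continuous_const).inter ?_
    refine (isClosed_eq (hA.matrix_mulVec hu) (hq.smul hu)).inter ?_
    refine (isClosed_eq (hA.matrix_mulVec hv) (hq.smul hv)).inter ?_
    exact isOpen_interior.isClosed_compl.preimage (continuous_fst.prodMk hq)
  have hCc : IsCompact C := by
    refine IsCompact.of_isClosed_subset ((isCompact_closedBall A₀ 1).prod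
      ((isCompact_closedBall 0 1).prod (isCompact_closedBall 0 1))) hC ?_
    rintro p ⟨h1, h2, h3, -⟩
    exact ⟨h1, mem_closedBall_zero_iff.2 (norm_le_one_of_dotProduct_self h2),
      mem_closedBall_zero_iff.2 (norm_le_one_of_dotProduct_self h3)⟩
  have hnot : A₀ ∉ Prod.fst '' C := by
    rintro ⟨⟨A, u, v⟩, ⟨-, h1, h2, h3, h4, h5, h6⟩, rfl⟩
    have hli := linearIndependent_of_orthonormal_pair h1 h2 h3
    have h7 : 2 ≤ finrank ℝ (tailKer 0 0 (A.1 - q (A, u, v) • 1)) := by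
      have hli' : LinearIndependent ℝ
          ![(⟨u, mem_tailKer_zero_zero.2 h4⟩ : tailKer 0 0 (A.1 - q (A, u, v) • 1)),
            ⟨v, mem_tailKer_zero_zero.2 h5⟩] :=
        LinearIndependent.pair_iff.2 fun s t h =>
          LinearIndependent.pair_iff.1 hli s t (congrArg Subtype.val h)
      simpa using hli'.fintype_card_le_finrank
    have h8 : q (A, u, v) = μ₀ := huniq _ h7
    refine h6 ?_
    change (A, q (A, u, v)) ∈ interior W
    rw [h8]
    exact mem_interior_iff_mem_nhds.2 hW
  filter_upwards [(hCc.image continuous_fst).isClosed.isOpen_compl.mem_nhds hnot,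
    Metric.closedBall_mem_nhds A₀ one_pos] with A hA1 hA2 μ hμ
  obtain ⟨u, hu, v, hv, huu, hvv, huv⟩ := exists_orthonormal_pair hμ
  rw [mem_tailKer_zero_zero] at hu hv
  have hqμ : q (A, u, v) = μ := by
    change u ⬝ᵥ A.1.mulVec u = μ
    rw [hu, dotProduct_smul, huu, smul_eq_mul, mul_one]
  by_contra hAW
  refine hA1 ⟨(A, u, v), ⟨hA2, huu, hvv, huv, ?_, ?_, ?_⟩, rfl⟩
  · change A.1.mulVec u = q (A, u, v) • u
    rw [hqμ, hu]
  · change A.1.mulVec v = q (A, u, v) • v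
    rw [hqμ, hv]
  · change (A, q (A, u, v)) ∈ (interior W)ᶜ
    rw [hqμ]
    exact fun h => hAW (interior_subset h)

end SmoothPart

/-! ### The local equations of the derogatory set -/

section Chart

variable {n k : ℕ}

/-- The entries of the compression of `A - μ` to analytic families of vectors. -/
noncomputable def compression (U V : bandedSymm n k × ℝ → Fin n → ℝ) (z : bandedSymm n k × ℝ) : ℝ :=
  dotProductCLM n (U z) (shiftMulVec n k z (V z))

theorem compression_apply (U V : bandedSymm n k × ℝ → Fin n → ℝ) (z : bandedSymm n k × ℝ) :
    compression U V z = U z ⬝ᵥ (z.1.1 - z.2 • 1).mulVec (V z) := by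
  rw [← shiftMulVec_apply]
  rfl

theorem contDiffAt_compression {U V : bandedSymm n k × ℝ → Fin n → ℝ} {z₀ : bandedSymm n k × ℝ}
    (hU : ContDiffAt ℝ ω U z₀) (hV : ContDiffAt ℝ ω V z₀) :
    ContDiffAt ℝ ω (compression U V) z₀ :=
  ((dotProductCLM n).contDiff.contDiffAt.comp z₀ hU).clm_apply
    ((shiftMulVec n k).contDiff.contDiffAt.clm_apply hV)

/-- The derivatives of `U` and `V` drop out because at `z₀` both vectors lie in the kernel of the
symmetric matrix `A - μ`. -/
theorem fderiv_compression {U V : bandedSymm n k × ℝ → Fin n → ℝ} {z₀ : bandedSymm n k × ℝ}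
    (hU : ContDiffAt ℝ ω U z₀) (hV : ContDiffAt ℝ ω V z₀)
    (hU₀ : U z₀ ∈ tailKer 0 0 (z₀.1.1 - z₀.2 • 1)) (hV₀ : V z₀ ∈ tailKer 0 0 (z₀.1.1 - z₀.2 • 1))
    (h : bandedSymm n k × ℝ) :
    fderiv ℝ (compression U V) z₀ h = U z₀ ⬝ᵥ (h.1.1 - h.2 • 1).mulVec (V z₀) := by
  have h1 : HasFDerivAt (fun z => dotProductCLM n (U z))
      ((dotProductCLM n).comp (fderiv ℝ U z₀)) z₀ :=
    (dotProductCLM n).hasFDerivAt.comp z₀ (hU.differentiableAt (by simp)).hasFDerivAt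
  have h2 : HasFDerivAt (fun z => shiftMulVec n k z (V z)) _ z₀ :=
    (shiftMulVec n k).hasFDerivAt.clm_apply (hV.differentiableAt (by simp)).hasFDerivAt
  have h3 : fderiv ℝ (compression U V) z₀ = _ := (h1.clm_apply h2).fderiv
  rw [h3]
  change U z₀ ⬝ᵥ (shiftMulVec n k z₀ (fderiv ℝ V z₀ h) + shiftMulVec n k h (V z₀)) +
    fderiv ℝ U z₀ h ⬝ᵥ shiftMulVec n k z₀ (V z₀) = _
  have h4 : shiftMulVec n k z₀ (V z₀) = 0 := by
    rw [shiftMulVec_apply]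
    exact funext fun l => hV₀.2 l (Nat.zero_le _)
  have h5 : U z₀ ⬝ᵥ shiftMulVec n k z₀ (fderiv ℝ V z₀ h) = 0 := by
    rw [shiftMulVec_apply]
    exact dotProduct_mulVec_eq_zero_of_mem_tailKer (sub_smul_one_isSymm z₀.1 z₀.2) hU₀
      fun l hl => absurd hl (Nat.not_lt_zero _)
  rw [h4, dotProduct_zero, add_zero, dotProduct_add, h5, zero_add, shiftMulVec_apply]

/-- The compression of banded symmetric matrices to a pair of vectors in reduced form is onto. -/
theorem exists_compression_eq {x y : Fin n → ℝ} {i j : Fin n} (hxi : x i = 1) (hxj : x j = 0)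
    (hyi : y i = 0) (hyj : y j = 1)
    (hxy : ∃ p q : Fin n, ((q : ℤ) - (p : ℤ)).natAbs ≤ k ∧ x p * y q + x q * y p ≠ 0)
    (α β γ : ℝ) : ∃ H : bandedSymm n k, x ⬝ᵥ H.1.mulVec x = α ∧ y ⬝ᵥ H.1.mulVec x = β ∧
      y ⬝ᵥ H.1.mulVec y = γ := by
  obtain ⟨p, q, hpq, h0⟩ := hxy
  have hunit : ∀ (l m : Fin n) (h : ((m : ℤ) - (l : ℤ)).natAbs ≤ k) (r s : Fin n → ℝ),
      r ⬝ᵥ (bandUnit l m h).1.mulVec s = r l * s m + r m * s l := fun l m h =>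
    dotProduct_symUnit_mulVec l m
  set δ := x p * y q + x q * y p with hδ
  have h1 : y p * x q + y q * x p = δ := by rw [hδ]; ring
  -- The unit at `(p, q)` produces the mixed entry, and the diagonal units, blind to it, correct the
  -- outer ones. The halves appear because `symUnit i i` has the entry 2.
  refine ⟨((α - β / δ * (x p * x q + x q * x p)) / 2) • bandUnit i i (by simp) +
    ((γ - β / δ * (y p * y q + y q * y p)) / 2) • bandUnit j j (by simp) +
    (β / δ) • bandUnit p q hpq, ?_, ?_, ?_⟩
  · rw [dotProduct_combination_mulVec, hunit, hunit, hunit, hxi, hxj]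
    ring
  · rw [dotProduct_combination_mulVec, hunit, hunit, hunit, hxi, hxj, hyi, hyj, h1,
      div_mul_cancel₀ _ h0]
    ring
  · rw [dotProduct_combination_mulVec, hunit, hunit, hunit, hyi, hyj]
    ring

/-- Ensures that the natural-number subtractions `N - 2` and `N - 3` are not truncated, hence `N - 3
< N - 2`. -/
theorem three_le_finrank_bandedSymm {x y : Fin n → ℝ} {i j : Fin n} (hxi : x i = 1)
    (hxj : x j = 0) (hyi : y i = 0) (hyj : y j = 1)
    (hxy : ∃ p q : Fin n, ((q : ℤ) - (p : ℤ)).natAbs ≤ k ∧ x p * y q + x q * y p ≠ 0) :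
    3 ≤ finrank ℝ (bandedSymm n k) := by
  let c : (Fin n → ℝ) → (Fin n → ℝ) → bandedSymm n k →ₗ[ℝ] ℝ := fun u v =>
    (((dotProductCLM n u).comp ((bandedMulVec n k).flip v) : bandedSymm n k →L[ℝ] ℝ) :
      bandedSymm n k →ₗ[ℝ] ℝ)
  have hsurj : Function.Surjective ((c x x).prod ((c y x).prod (c y y))) := by
    rintro ⟨α, β, γ⟩
    obtain ⟨H, h1, h2, h3⟩ := exists_compression_eq hxi hxj hyi hyj hxy α β γ
    exact ⟨H, Prod.ext h1 (Prod.ext h2 h3)⟩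
  have := LinearMap.finrank_le_finrank_of_surjective hsurj
  simpa using this

/-- Near a matrix with a single multiple eigenvalue, which is double and nondegenerate, the
derogatory matrices form a submanifold. -/
theorem exists_submanifold_nhds {A₀ : bandedSymm n k} {μ₀ : ℝ} {x y : Fin n → ℝ} {i j : Fin n}
    (huniq : ∀ μ : ℝ, 2 ≤ finrank ℝ (tailKer 0 0 (A₀.1 - μ • 1)) → μ = μ₀)
    (hx : x ∈ tailKer 0 0 (A₀.1 - μ₀ • 1)) (hy : y ∈ tailKer 0 0 (A₀.1 - μ₀ • 1))
    (hxi : x i = 1) (hxj : x j = 0) (hyi : y i = 0) (hyj : y j = 1)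
    (hfull : ∀ w ∈ tailKer 0 0 (A₀.1 - μ₀ • 1), w i = 0 → w j = 0 → w = 0)
    (hxy : ∃ p q : Fin n, ((q : ℤ) - (p : ℤ)).natAbs ≤ k ∧ x p * y q + x q * y p ≠ 0) :
    ∃ U, IsOpen U ∧ A₀ ∈ U ∧ IsEmbeddedSubmanifold (finrank ℝ (bandedSymm n k) - 2)
      ({A : bandedSymm n k | IsDerogatory A.1} ∩ U) := by
  obtain ⟨X, Y, hX, hY, hX₀, hY₀, hev⟩ :=
    exists_analytic_pivots (z₀ := (A₀, μ₀)) hx hy hxi hxj hyi hyj hfull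
  have hij : i ≠ j := by rintro rfl; rw [hxi] at hxj; exact one_ne_zero hxj
  have hx' : X (A₀, μ₀) ∈ tailKer 0 0 (A₀.1 - μ₀ • 1) := hX₀ ▸ hx
  have hy' : Y (A₀, μ₀) ∈ tailKer 0 0 (A₀.1 - μ₀ • 1) := hY₀ ▸ hy
  set g₁ := compression X X with hg₁
  set g₂ := compression Y X with hg₂
  set g₃ := compression Y Y with hg₃
  have cg₁ : ContDiffAt ℝ ω g₁ (A₀, μ₀) := contDiffAt_compression hX hX
  have cg₂ : ContDiffAt ℝ ω g₂ (A₀, μ₀) := contDiffAt_compression hY hX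
  have cg₃ : ContDiffAt ℝ ω g₃ (A₀, μ₀) := contDiffAt_compression hY hY
  have dg₁ : ∀ h, fderiv ℝ g₁ (A₀, μ₀) h = x ⬝ᵥ (h.1.1 - h.2 • 1).mulVec x := fun h => by
    rw [hg₁, fderiv_compression hX hX hx' hx', hX₀]
  have dg₂ : ∀ h, fderiv ℝ g₂ (A₀, μ₀) h = y ⬝ᵥ (h.1.1 - h.2 • 1).mulVec x := fun h => by
    rw [hg₂, fderiv_compression hY hX hy' hx', hX₀, hY₀]
  have dg₃ : ∀ h, fderiv ℝ g₃ (A₀, μ₀) h = y ⬝ᵥ (h.1.1 - h.2 • 1).mulVec y := fun h => by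
    rw [hg₃, fderiv_compression hY hY hy' hy', hY₀]
  have hxx := dotProduct_self_ne_zero (ne_zero_of_apply_eq_one hxi)
  -- vanishing of the compression is equivalent to a multiple eigenvalue
  have hker : ∀ᶠ z in 𝓝 (A₀, μ₀), 2 ≤ finrank ℝ (tailKer 0 0 (z.1.1 - z.2 • 1)) ↔
      g₁ z = 0 ∧ g₂ z = 0 ∧ g₃ z = 0 := by
    filter_upwards [hev] with z hz
    obtain ⟨h1, h2, h3, h4, h5, h6, h7⟩ := hz
    rw [hg₁, hg₂, hg₃, compression_apply, compression_apply, compression_apply]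
    set B : Matrix (Fin n) (Fin n) ℝ := z.1.1 - z.2 • 1 with hB
    constructor
    · intro hrk
      have hle : tailKer 0 0 B ≤ Submodule.span ℝ {X z, Y z} := fun w hw =>
        Submodule.mem_span_pair.2 ⟨w i, w j, (h7 w hw).symm⟩
      have hspan : finrank ℝ (Submodule.span ℝ {X z, Y z}) ≤ 2 := by
        have := finrank_range_le_card (R := ℝ) ![X z, Y z]
        have hr : range ![X z, Y z] = {X z, Y z} := by simp [Set.pair_comm]
        rwa [hr, Set.finrank, Fintype.card_fin] at this
      have heq := Submodule.eq_of_le_of_finrank_le hle (hspan.trans hrk)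
      have hXB : B.mulVec (X z) = 0 := funext fun l =>
        ((heq ▸ Submodule.subset_span (by simp) : X z ∈ tailKer 0 0 B)).2 l (Nat.zero_le _)
      have hYB : B.mulVec (Y z) = 0 := funext fun l =>
        ((heq ▸ Submodule.subset_span (by simp) : Y z ∈ tailKer 0 0 B)).2 l (Nat.zero_le _)
      simp [hXB, hYB]
    -- Through the pivots, the compression entries are the residual entries of `X` and `Y` in the
    -- rows `i`, `j`; symmetry supplies the fourth.
    · rintro ⟨e1, e2, e3⟩
      have hsum : ∀ u v : Fin n → ℝ, (∀ l, ¬(l = i ∨ l = j) → B.mulVec v l = 0) →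
          u ⬝ᵥ B.mulVec v = u i * B.mulVec v i + u j * B.mulVec v j := by
        intro u v hv
        refine Fintype.sum_eq_add i j hij fun l hl => ?_
        rw [hv l (by tauto), mul_zero]
      have e2' : X z ⬝ᵥ B.mulVec (Y z) = 0 := by
        rw [IsSymm.dotProduct_mulVec_comm (sub_smul_one_isSymm z.1 z.2), e2]
      rw [hsum _ _ h5, h1, h2] at e1
      rw [hsum _ _ h5, h3, h4] at e2
      rw [hsum _ _ h6, h3, h4] at e3
      rw [hsum _ _ h6, h1, h2] at e2'
      have hmem : ∀ v : Fin n → ℝ, (∀ l, ¬(l = i ∨ l = j) → B.mulVec v l = 0) →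
          B.mulVec v i = 0 → B.mulVec v j = 0 → v ∈ tailKer 0 0 B := by
        intro v hv hvi hvj
        refine ⟨fun l hl => absurd hl (Nat.not_lt_zero _), fun l _ => ?_⟩
        by_cases hl : l = i ∨ l = j
        · rcases hl with rfl | rfl
          · exact hvi
          · exact hvj
        · exact hv l hl
      exact two_le_finrank_of_pivots (hmem _ h5 (by linarith) (by linarith))
        (hmem _ h6 (by linarith) (by linarith)) h1 h2 h3 h4
  have hzero : g₁ (A₀, μ₀) = 0 ∧ g₂ (A₀, μ₀) = 0 ∧ g₃ (A₀, μ₀) = 0 :=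
    hker.self_of_nhds.1 (two_le_finrank_of_pivots hx hy hxi hxj hyi hyj)
  -- the candidate for the multiple eigenvalue as a function of the matrix
  have hω : (ω : WithTop ℕ∞) ≠ 0 := by simp
  have hinv : (fderiv ℝ g₁ (A₀, μ₀) ∘L .inr ℝ (bandedSymm n k) ℝ).IsInvertible := by
    have hval : ∀ s : ℝ, (fderiv ℝ g₁ (A₀, μ₀) ∘L .inr ℝ (bandedSymm n k) ℝ) s =
        -(x ⬝ᵥ x) * s := by
      intro s
      rw [ContinuousLinearMap.comp_apply, ContinuousLinearMap.inr_apply, dg₁,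
        sub_smul_one_mulVec, dotProduct_sub, dotProduct_smul]
      simp
      ring
    refine ⟨ContinuousLinearEquiv.unitsEquivAut ℝ (Units.mk0 (-(x ⬝ᵥ x)) (neg_ne_zero.2 hxx)), ?_⟩
    ext
    rw [hval]
    simp
  let ψ := cg₁.implicitFunction hω hinv
  have hψ₀ : ψ A₀ = μ₀ := cg₁.implicitFunction_apply_self hω hinv
  have hψ : ContDiffAt ℝ ω ψ A₀ := cg₁.contDiffAt_implicitFunction hω hinv
  have hψ_iff : ∀ᶠ z in 𝓝 (A₀, μ₀), g₁ z = 0 ↔ ψ z.1 = z.2 := by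
    have := cg₁.eventually_apply_eq_iff_implicitFunction hω hinv
    rwa [hzero.1] at this
  let Γ : bandedSymm n k → bandedSymm n k × ℝ := fun A => (A, ψ A)
  have hΓ₀ : Γ A₀ = (A₀, μ₀) := Prod.ext rfl hψ₀
  have hΓ : ContDiffAt ℝ ω Γ A₀ := contDiffAt_id.prodMk hψ
  have hΓt : Filter.Tendsto Γ (𝓝 A₀) (𝓝 (A₀, μ₀)) := by
    have := hΓ.continuousAt
    rwa [ContinuousAt, hΓ₀] at this
  have hΓ' : ∀ H, fderiv ℝ Γ A₀ H = (H, fderiv ℝ ψ A₀ H) := by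
    intro H
    have h1 := (hasFDerivAt_id (𝕜 := ℝ) A₀).prodMk (hψ.differentiableAt hω).hasFDerivAt
    have h2 : fderiv ℝ Γ A₀ = _ := h1.fderiv
    rw [h2]
    rfl
  have hcomp : ∀ {g : bandedSymm n k × ℝ → ℝ}, ContDiffAt ℝ ω g (A₀, μ₀) →
      ContDiffAt ℝ ω (g ∘ Γ) A₀ := fun {g} hg => ContDiffAt.comp A₀ (hΓ₀ ▸ hg) hΓ
  have hcomp' : ∀ {g : bandedSymm n k × ℝ → ℝ}, ContDiffAt ℝ ω g (A₀, μ₀) → ∀ H,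
      fderiv ℝ (g ∘ Γ) A₀ H = fderiv ℝ g (A₀, μ₀) (H, fderiv ℝ ψ A₀ H) := by
    intro g hg H
    have h1 : HasFDerivAt g (fderiv ℝ g (A₀, μ₀)) (Γ A₀) :=
      hΓ₀ ▸ (hg.differentiableAt hω).hasFDerivAt
    have h2 : fderiv ℝ (g ∘ Γ) A₀ = _ :=
      (h1.comp A₀ (hΓ.differentiableAt hω).hasFDerivAt).fderiv
    rw [h2, ← hΓ']
    rfl
  have hg₁Γ : ∀ᶠ A in 𝓝 A₀, (g₁ ∘ Γ) A = 0 := by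
    filter_upwards [hΓt.eventually hψ_iff] with A hA
    exact hA.2 rfl
  have hdψ : ∀ H, x ⬝ᵥ H.1.mulVec x = 0 → fderiv ℝ ψ A₀ H = 0 := by
    intro H hH
    have h1 : fderiv ℝ (g₁ ∘ Γ) A₀ = 0 := by
      have h2 : (g₁ ∘ Γ) =ᶠ[𝓝 A₀] fun _ => (0 : ℝ) := hg₁Γ
      rw [h2.fderiv_eq]
      simp
    have h3 := hcomp' cg₁ H
    rw [h1, dg₁, sub_smul_one_mulVec, dotProduct_sub, dotProduct_smul, hH] at h3
    simp only [zero_apply, zero_sub, smul_eq_mul] at h3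
    exact (mul_eq_zero.1 (neg_eq_zero.1 h3.symm)).resolve_right hxx
  let h : bandedSymm n k → ℝ × ℝ := fun A => ((g₂ ∘ Γ) A, (g₃ ∘ Γ) A)
  have hh : ContDiffAt ℝ ω h A₀ := (hcomp cg₂).prodMk (hcomp cg₃)
  have hh' : ∀ H, fderiv ℝ h A₀ H = (fderiv ℝ (g₂ ∘ Γ) A₀ H, fderiv ℝ (g₃ ∘ Γ) A₀ H) := by
    intro H
    have h1 := ((hcomp cg₂).differentiableAt hω).hasFDerivAt.prodMk
      ((hcomp cg₃).differentiableAt hω).hasFDerivAt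
    have h2 : fderiv ℝ h A₀ = _ := h1.fderiv
    rw [h2]
    rfl
  refine exists_isEmbeddedSubmanifold_of_submersion hh ?_ ?_ ?_
  · rintro ⟨β, γ⟩
    -- With first entry `0` the derivative of `ψ` along `H` vanishes, so no drift of `μ` disturbs
    -- the other two entries.
    obtain ⟨H, h1, h2, h3⟩ := exists_compression_eq hxi hxj hyi hyj hxy 0 β γ
    refine ⟨H, ?_⟩
    refine (hh' H).trans ?_
    rw [hcomp' cg₂, hcomp' cg₃, hdψ H h1, dg₂, dg₃]
    simp only [zero_smul, sub_zero, h2, h3]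
  -- For `A` near `A₀` any multiple eigenvalue is close to `μ₀`, hence equal to `ψ A`.
  · filter_upwards [hg₁Γ, hΓt.eventually hker,
      eventually_multiple_eigenvalue_mem huniq (hker.and hψ_iff)] with A hA1 hA2 hA3
    refine isDerogatory_iff.trans ?_
    constructor
    · rintro ⟨μ, hμ⟩
      obtain ⟨h1, h2⟩ := hA3 μ hμ
      obtain ⟨e1, e2, e3⟩ := h1.1 hμ
      have h3 : ψ A = μ := h2.1 e1
      have h4 : Γ A = (A, μ) := Prod.ext rfl h3
      refine Prod.ext ?_ ?_
      · change g₂ (Γ A) = 0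
        rw [h4, e2]
      · change g₃ (Γ A) = 0
        rw [h4, e3]
    · intro hA
      obtain ⟨e2, e3⟩ := Prod.ext_iff.1 hA
      exact ⟨ψ A, hA2.2 ⟨hA1, e2, e3⟩⟩
  · have := three_le_finrank_bandedSymm (k := k) hxi hxj hyi hyj hxy
    rw [finrank_prod, finrank_self]
    omega

end Chart

/-! ### Gluing, codimension two and explicit witnesses -/

theorem isEmbeddedSubmanifold_of_locally {E : Type*} [NormedAddCommGroup E] [NormedSpace ℝ E]
    {d : ℕ} {M : Set E} (h : ∀ x ∈ M, ∃ U M', IsOpen U ∧ x ∈ U ∧ IsEmbeddedSubmanifold d M' ∧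
      ∀ z ∈ U, z ∈ M ↔ z ∈ M') : IsEmbeddedSubmanifold d M := by
  intro x hx
  obtain ⟨U, M', hU, hxU, hM', hiff⟩ := h x hx
  obtain ⟨φ, L, hxφ, hφ, hφ', hL, himg⟩ := hM' x ((hiff x hxU).1 hx)
  have hsrc : (φ.restrOpen U hU).source = φ.source ∩ U := φ.restrOpen_source U hU
  have htgt : ∀ w ∈ (φ.restrOpen U hU).target, w ∈ φ.target ∧ φ.symm w ∈ φ.source ∩ U ∧
      φ (φ.symm w) = w := by
    intro w hw
    have h1 : φ.symm w ∈ φ.source ∩ U := hsrc ▸ (φ.restrOpen U hU).map_target hw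
    have h2 : φ (φ.symm w) = w := (φ.restrOpen U hU).right_inv hw
    exact ⟨h2 ▸ φ.map_source h1.1, h1, h2⟩
  refine ⟨φ.restrOpen U hU, L, hsrc ▸ ⟨hxφ, hxU⟩, hφ.mono (hsrc ▸ inter_subset_left),
    hφ'.mono fun w hw => (htgt w hw).1, hL, ?_⟩
  ext w
  constructor
  · rintro ⟨z, ⟨hz, hzM⟩, rfl⟩
    refine ⟨(φ.restrOpen U hU).map_source hz, ?_⟩
    rw [hsrc] at hz
    have : φ z ∈ φ '' (φ.source ∩ M') := ⟨z, ⟨hz.1, (hiff z hz.2).1 hzM⟩, rfl⟩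
    rw [himg] at this
    exact this.2
  · rintro ⟨hw, hwL⟩
    obtain ⟨h1, h2, h3⟩ := htgt w hw
    have : w ∈ φ '' (φ.source ∩ M') := by
      rw [himg]
      exact ⟨h1, hwL⟩
    obtain ⟨z, ⟨hz, hzM⟩, rfl⟩ := this
    rw [φ.left_inv hz] at h2
    exact ⟨z, ⟨hsrc ▸ h2, (hiff z h2.2).2 hzM⟩, rfl⟩

section Codimension

variable {n k : ℕ}

/-- The derogatory matrices in an open set have codimension two as soon as the set contains a
matrix with a single multiple eigenvalue that is double and nondegenerate. -/
theorem hasCodimension_two_of_mem (hk : 0 < k) (hn : 0 < n) {Ω : Set (bandedSymm n k)}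
    (hΩ : IsOpen Ω) {A₀ : bandedSymm n k} (hA₀ : A₀ ∈ Ω) {μ₀ : ℝ} {x y : Fin n → ℝ} {i j : Fin n}
    (huniq : ∀ μ : ℝ, 2 ≤ finrank ℝ (tailKer 0 0 (A₀.1 - μ • 1)) → μ = μ₀)
    (hx : A₀.1.mulVec x = μ₀ • x) (hy : A₀.1.mulVec y = μ₀ • y)
    (hxi : x i = 1) (hxj : x j = 0) (hyi : y i = 0) (hyj : y j = 1)
    (hfull : ∀ w, A₀.1.mulVec w = μ₀ • w → w i = 0 → w j = 0 → w = 0)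
    (hxy : ∃ p q : Fin n, ((q : ℤ) - (p : ℤ)).natAbs ≤ k ∧ x p * y q + x q * y p ≠ 0) :
    HasCodimension ({A : bandedSymm n k | IsDerogatory A.1} ∩ Ω) 2 := by
  set D : Set (bandedSymm n k) := {A : bandedSymm n k | IsDerogatory A.1} with hD
  rw [← mem_tailKer_zero_zero] at hx hy
  simp only [← mem_tailKer_zero_zero] at hfull
  have h3 := three_le_finrank_bandedSymm (k := k) hxi hxj hyi hyj hxy
  let d := finrank ℝ (bandedSymm n k) - 2
  -- The largest open set in which `D` is a submanifold of dimension `d`: a derogatory matrix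
  -- outside it must be exceptional.
  let V : Set (bandedSymm n k) := ⋃₀ {U | IsOpen U ∧ IsEmbeddedSubmanifold d (D ∩ U)}
  have hV : IsOpen V := isOpen_sUnion fun U hU => hU.1
  refine ⟨d, V, hV, ?_, ?_, by omega, fun _ => ?_⟩
  · obtain ⟨U, hU, hAU, hDU⟩ := exists_submanifold_nhds huniq hx hy hxi hxj hyi hyj hfull hxy
    exact ⟨A₀, ⟨isDerogatory_iff.2 ⟨μ₀, two_le_finrank_of_pivots hx hy hxi hxj hyi hyj⟩, hA₀⟩,
      U, ⟨hU, hDU⟩, hAU⟩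
  · refine isEmbeddedSubmanifold_of_locally fun A hA => ?_
    obtain ⟨⟨hAD, hAΩ⟩, U, ⟨hU, hDU⟩, hAU⟩ := hA
    refine ⟨U ∩ Ω, D ∩ U, hU.inter hΩ, ⟨hAU, hAΩ⟩, hDU, fun z hz => ?_⟩
    exact ⟨fun h => ⟨h.1.1, hz.1⟩, fun h => ⟨⟨h.1, hz.2⟩, U, ⟨hU, hDU⟩, hz.1⟩⟩
  · refine lt_of_le_of_lt ((dimH_mono ?_).trans (dimH_exceptional_le (n := n) hk hn)) ?_
    · rintro A ⟨⟨hAD, -⟩, hAV⟩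
      by_contra hA
      simp only [mem_ofPred_eq, not_or] at hA
      obtain ⟨h1, h2, h4⟩ := hA
      push Not at h1 h2
      obtain ⟨μ, hμ⟩ := isDerogatory_iff.1 hAD
      have huniq' : ∀ ν : ℝ, 2 ≤ finrank ℝ (tailKer 0 0 (A.1 - ν • 1)) → ν = μ := by
        intro ν hν
        by_contra hne
        exact h4 ⟨ν, μ, hne, hν, hμ⟩
      obtain ⟨i, j, x, hx, y, hy, hxi, hxj, hyi, hyj⟩ := exists_pivots hμ
      obtain ⟨U, hU, hAU, hDU⟩ := exists_submanifold_nhds huniq' hx hy hxi hxj hyi hyj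
        (fun w hw => eq_zero_of_pivots (Nat.lt_succ_iff.1 (h1 μ)) hx hy hxi hxj hyi hyj hw)
        (exists_band_ne_zero (h2 μ) hx hy (ne_zero_of_apply_eq_one hxi)
          (ne_zero_of_apply_eq_one hyj))
      exact hAV ⟨U, ⟨hU, hDU⟩, hAU⟩
    · exact_mod_cast (by omega : finrank ℝ (bandedSymm n k) - 3 < d)

theorem isOpen_setOf_bandwidth_eq (hk : 0 < k) :
    IsOpen {A : bandedSymm n k | bandwidth A.1 = k} := by
  have : {A : bandedSymm n k | bandwidth A.1 = k}ᶜ =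
      {A | ∀ i j : Fin n, k - 1 < ((j : ℤ) - (i : ℤ)).natAbs → A.1 i j = 0} := by
    ext A
    have h1 : bandwidth A.1 ≤ k := A.2.2
    have h2 : bandwidth A.1 ≠ k ↔ bandwidth A.1 ≤ k - 1 := by omega
    exact h2.trans (bandwidth_le_iff _ _)
  rw [← isClosed_compl_iff, this]
  simp only [ofPred_forall]
  refine isClosed_iInter fun i => isClosed_iInter fun j => isClosed_iInter fun _ => ?_
  exact isClosed_eq (continuous_subtype_val.matrix_elem i j) continuous_const

/-- Witness: indices `0` and `k` carry a block with zero diagonal and off-diagonal entry 1, with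
eigenvalues `±1`; the remaining diagonal entries are distinct integers, the least being 1 at `j`.
Thus 1 is the only multiple eigenvalue, it is double, and the bandwidth is exactly `k`. -/
theorem hasCodimension_two_of_three_le (hk : 0 < k) (hkn : k ≤ n - 1) (hn : 3 ≤ n)
    {Ω : Set (bandedSymm n k)} (hΩ : IsOpen Ω)
    (hsub : {A : bandedSymm n k | bandwidth A.1 = k} ⊆ Ω) :
    HasCodimension ({A : bandedSymm n k | IsDerogatory A.1} ∩ Ω) 2 := by
  let o : Fin n := ⟨0, by omega⟩
  let s : Fin n := ⟨k, by omega⟩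
  have hos : o ≠ s := fun h => by
    have := congrArg Fin.val h
    simp only [o, s] at this
    omega
  have hnear : ((s : ℤ) - (o : ℤ)).natAbs ≤ k := by simp [o, s]
  -- The least index outside the block is 2 when `k = 1` (a neighbour of `s`), and 1 otherwise (a
  -- neighbour of `o`); nearness makes the double eigenvalue nondegenerate.
  obtain ⟨j, hjo, hjs, hmin, p, hp, hpj⟩ : ∃ j : Fin n, j ≠ o ∧ j ≠ s ∧
      (∀ l, l ≠ o → l ≠ s → j ≤ l) ∧ ∃ p, (p = o ∨ p = s) ∧ ((j : ℤ) - (p : ℤ)).natAbs ≤ k := by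
    rcases Nat.lt_or_ge k 2 with h | h
    · refine ⟨⟨2, by omega⟩, ?_, ?_, fun l hlo hls => ?_, s, Or.inr rfl, ?_⟩
      · simp [o, Fin.ext_iff]
      · simp only [s, ne_eq, Fin.ext_iff]; omega
      · simp only [o, s, ne_eq, Fin.ext_iff, Fin.le_def] at *
        omega
      · simp only [s]; omega
    · refine ⟨⟨1, by omega⟩, ?_, ?_, fun l hlo hls => ?_, o, Or.inl rfl, ?_⟩
      · simp [o, Fin.ext_iff]
      · simp only [s, ne_eq, Fin.ext_iff]; omega
      · simp only [o, s, ne_eq, Fin.ext_iff, Fin.le_def] at *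
        omega
      · simp only [o]; omega
  let c : Fin n → ℝ := fun l => if l = o ∨ l = s then 0 else (l.val : ℝ) - j.val + 1
  let A₀ : bandedSymm n k := bandDiagonal n k c + bandUnit o s hnear
  have hmul : ∀ w l, A₀.1.mulVec w l =
      c l * w l + ((Pi.single o (w s) : Fin n → ℝ) l + (Pi.single s (w o) : Fin n → ℝ) l) := by
    intro w l
    change ((bandDiagonal n k c).1 + symUnit o s).mulVec w l = _
    rw [Matrix.add_mulVec, symUnit_mulVec, Pi.add_apply, bandDiagonal_mulVec]
    rfl
  have hco : c o = 0 := by simp [c]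
  have hcs : c s = 0 := by simp [c]
  have hcl : ∀ l, l ≠ o → l ≠ s → c l = (l.val : ℝ) - j.val + 1 := by
    intro l h1 h2
    simp [c, h1, h2]
  have hcj : c j = 1 := by rw [hcl j hjo hjs]; ring
  have heig : ∀ (μ : ℝ) (w : Fin n → ℝ), A₀.1.mulVec w = μ • w →
      w s = μ * w o ∧ w o = μ * w s ∧ ∀ l, l ≠ o → l ≠ s → c l * w l = μ * w l := by
    intro μ w hw
    have h : ∀ l, c l * w l + ((Pi.single o (w s) : Fin n → ℝ) l +
        (Pi.single s (w o) : Fin n → ℝ) l) = μ * w l := fun l => by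
      rw [← hmul, hw]; rfl
    refine ⟨?_, ?_, fun l hlo hls => ?_⟩
    · simpa [hco, hos] using h o
    · simpa [hcs, hos.symm] using h s
    · simpa [hlo, hls] using h l
  have hinjc : ∀ l m, l ≠ o → l ≠ s → m ≠ o → m ≠ s → c l = c m → l = m := by
    intro l m h1 h2 h3 h4 h
    rw [hcl l h1 h2, hcl m h3 h4] at h
    have : (l.val : ℝ) = m.val := by linarith
    exact Fin.ext (by exact_mod_cast this)
  have hA₀ : bandwidth A₀.1 = k := by
    have hle : bandwidth A₀.1 ≤ k := A₀.2.2
    by_contra hne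
    have h1 : bandwidth A₀.1 ≤ k - 1 := by omega
    have h2 := (bandwidth_le_iff _ _).1 h1 o s (by simp [o, s]; omega)
    have h3 : A₀.1 o s = Matrix.diagonal c o s + symUnit o s o s := rfl
    rw [h3, Matrix.diagonal_apply_ne _ hos] at h2
    simp [symUnit, hos.symm] at h2
  refine hasCodimension_two_of_mem hk (by omega) hΩ (hsub hA₀) (μ₀ := 1)
    (x := Pi.single o 1 + Pi.single s 1) (y := Pi.single j 1) (i := o) (j := j) ?_ ?_ ?_ ?_ ?_ ?_ ?_
    ?_ ?_
  · intro μ hμ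
    by_contra hne
    -- An eigenspace detected by one coordinate is at most a line. Take `o` for `μ = -1`, the index
    -- with `c m = μ` for another diagonal entry, and any index if `μ` is no eigenvalue.
    obtain ⟨m, hm⟩ : ∃ m, ∀ w : Fin n → ℝ, A₀.1.mulVec w = μ • w → w m = 0 → w = 0 := by
      by_cases hμ1 : μ = -1
      · refine ⟨o, fun w hw hwo => ?_⟩
        obtain ⟨h1, h2, h3⟩ := heig μ w hw
        funext l
        by_cases hlo : l = o
        · rw [hlo, hwo]; rfl
        by_cases hls : l = s
        · rw [hls, h1, hwo, mul_zero]; rfl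
        have h4 := h3 l hlo hls
        have h5 : (j.val : ℝ) ≤ l.val := by exact_mod_cast hmin l hlo hls
        rw [hcl l hlo hls, hμ1] at h4
        have h6 : ((l.val : ℝ) - j.val + 2) * w l = 0 := by linarith
        exact (mul_eq_zero.1 h6).resolve_left (by linarith)
      · have hzero : ∀ w : Fin n → ℝ, A₀.1.mulVec w = μ • w → w o = 0 ∧ w s = 0 := by
          intro w hw
          obtain ⟨h1, h2, -⟩ := heig μ w hw
          have h4 : (1 - μ) * ((1 + μ) * w o) = 0 := by linear_combination h2 + μ * h1
          have h5 : w o = 0 := (mul_eq_zero.1 ((mul_eq_zero.1 h4).resolve_left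
            fun h => hne (by linarith))).resolve_left fun h => hμ1 (by linarith)
          exact ⟨h5, by rw [h1, h5, mul_zero]⟩
        by_cases hex : ∃ m, m ≠ o ∧ m ≠ s ∧ c m = μ
        · obtain ⟨m, hmo, hms, hmμ⟩ := hex
          refine ⟨m, fun w hw hwm => ?_⟩
          obtain ⟨h1, h2⟩ := hzero w hw
          obtain ⟨-, -, h3⟩ := heig μ w hw
          funext l
          by_cases hlo : l = o
          · rw [hlo, h1]; rfl
          by_cases hls : l = s
          · rw [hls, h2]; rfl
          by_cases hlm : l = m
          · rw [hlm, hwm]; rfl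
          have h4 : (c l - c m) * w l = 0 := by rw [hmμ]; linarith [h3 l hlo hls]
          exact (mul_eq_zero.1 h4).resolve_left fun h =>
            hlm (hinjc l m hlo hls hmo hms (by linarith))
        · refine ⟨o, fun w hw _ => ?_⟩
          obtain ⟨h1, h2⟩ := hzero w hw
          obtain ⟨-, -, h3⟩ := heig μ w hw
          funext l
          by_cases hlo : l = o
          · rw [hlo, h1]; rfl
          by_cases hls : l = s
          · rw [hls, h2]; rfl
          have h4 : (c l - μ) * w l = 0 := by linarith [h3 l hlo hls]
          exact (mul_eq_zero.1 h4).resolve_left fun h => hex ⟨l, hlo, hls, by linarith⟩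
    obtain ⟨w, hw, hw0, hwm⟩ := exists_ne_zero_apply_eq_zero hμ m
    exact hw0 (hm w (mem_tailKer_zero_zero.1 hw) hwm)
  · ext l
    rw [hmul, one_smul]
    by_cases hlo : l = o
    · subst hlo; simp [hco, hos, hos.symm]
    by_cases hls : l = s
    · subst hls; simp [hcs, hos, hos.symm]
    simp [hlo, hls]
  · ext l
    rw [hmul, one_smul]
    by_cases hlj : l = j
    · subst hlj; simp [hcj, hjo, hjs, hjo.symm, hjs.symm]
    · simp [hlj, hjo.symm, hjs.symm]
  · simp [hos]
  · simp [hjo, hjs]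
  · simp [hjo.symm]
  · simp
  · intro w hw hwo hwj
    obtain ⟨h1, -, h3⟩ := heig 1 w hw
    funext l
    by_cases hlo : l = o
    · rw [hlo, hwo]; rfl
    by_cases hls : l = s
    · rw [hls, h1, hwo, mul_zero]; rfl
    by_cases hlj : l = j
    · rw [hlj, hwj]; rfl
    have h4 : (c l - c j) * w l = 0 := by rw [hcj]; linarith [h3 l hlo hls]
    exact (mul_eq_zero.1 h4).resolve_left fun h =>
      hlj (hinjc l j hlo hls hjo hjs (by linarith))
  · refine ⟨p, j, hpj, ?_⟩
    rcases hp with rfl | rfl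
    · simp [hos, hjo, hjs]
    · simp [hos.symm, hjo, hjs]

/-- No index is left outside the block `{0, k}`, so the zero matrix is the witness. Derogatory
symmetric matrices of size 2 are scalar, hence never of bandwidth 1. -/
theorem hasCodimension_two_of_eq_two :
    HasCodimension ({A : bandedSymm 2 1 | IsDerogatory A.1} ∩ univ) 2 := by
  have hmul : ∀ (μ : ℝ) (w : Fin 2 → ℝ), (0 : bandedSymm 2 1).1.mulVec w = μ • w ↔ μ • w = 0 := by
    intro μ w
    change (0 : Matrix (Fin 2) (Fin 2) ℝ).mulVec w = μ • w ↔ _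
    rw [Matrix.zero_mulVec, eq_comm]
  refine hasCodimension_two_of_mem one_pos two_pos isOpen_univ (mem_univ 0) (μ₀ := 0)
    (x := Pi.single 0 1) (y := Pi.single 1 1) (i := 0) (j := 1) ?_ ?_ ?_ ?_ ?_ ?_ ?_ ?_ ?_
  · intro μ hμ
    obtain ⟨w, hw, hw0, -⟩ := exists_ne_zero_apply_eq_zero hμ 0
    exact (smul_eq_zero.1 ((hmul μ w).1 (mem_tailKer_zero_zero.1 hw))).resolve_right hw0
  · rw [hmul, zero_smul]
  · rw [hmul, zero_smul]
  · simp
  · simp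
  · simp
  · simp
  · intro w _ h0 h1
    funext l
    fin_cases l
    · exact h0
    · exact h1
  · exact ⟨0, 1, by simp, by simp⟩

end Codimension

theorem mainTheorem5 (n k : ℕ) (hk : 0 < k) (hkn : k ≤ n - 1) :
    HasCodimension
      {A : bandedSymm n k | IsDerogatory (A : Matrix (Fin n) (Fin n) ℝ)} 2 ∧
    (3 ≤ n → HasCodimension
      {A : bandedSymm n k | IsDerogatory (A : Matrix (Fin n) (Fin n) ℝ) ∧
        bandwidth (A : Matrix (Fin n) (Fin n) ℝ) = k} 2) := by
  refine ⟨?_, fun hn => hasCodimension_two_of_three_le hk hkn hn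
    (isOpen_setOf_bandwidth_eq hk) subset_rfl⟩
  rw [← inter_univ {A : bandedSymm n k | IsDerogatory (A : Matrix (Fin n) (Fin n) ℝ)}]
  rcases Nat.lt_or_ge n 3 with hn | hn
  · obtain rfl : n = 2 := by omega
    obtain rfl : k = 1 := by omega
    exact hasCodimension_two_of_eq_two
  · exact hasCodimension_two_of_three_le hk hkn hn isOpen_univ (subset_univ _)
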